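/- Setting. Finitely many 4-simplices $v\in V$ are glued in pairs along all of their tetrahedra, each pair of tetrahedra being identified by a bijection of vertices (for example, any triangulation of a closed 4-manifold, possibly degenerate, meaning that two 4-simplices may share several tetrahedra). Let $\Delta$ be the dual 2-complex: its vertices are the 4-simplices $v\in V$, its edges $e\in E$ are the tetrahedra of the glued complex, and its polygonal faces $f\in F$ are the triangles of the glued complex. Thus every $v$ lies on five edges and ten faces (one face for each pair of edges at $v$), every $e$ lies on four faces, and $\deg_V(f)$, $\deg_E(f)$ are the numbers of vertices and of edges of the polygon $f$ (all incidences are counted with multiplicity). Let $H_+^3=\{x\in\mathbb R^4: x\cdot x=1,\ x_0>0\}$, where $x\cdot y=x_0y_0-x_1y_1-x_2y_2-x_3y_3$, with its invariant volume $dx=d^3\vec x/x_0$ and hyperbolic distance $\phi(x,y)=\cosh^{-1}(x\cdot y)$. Put $$K_p(x,y)=\frac{\sin(p\,\phi(x,y))}{p\sinh\phi(x,y)},\qquad \Theta_4(p_1,\dots,p_4)=\frac{2}{\pi p_1p_2p_3p_4}\int_0^\infty\frac{\prod_{i=1}^4\sin(p_ir)}{\sinh^2 r}\,dr .$$ For each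 $v$ choose an edge $e_0^v\ni v$ and fix the value $x_{(e_0^v,v)}\in H_+^3$ arbitrarily; the variables $x_{(e,v)}\in H_+^3$, for $e\ni v$ with $e\ne e_0^v$, are free. For $f\ni v$ let $\phi^f_v=\phi(x_{(e_+,v)},x_{(e_-,v)})$, where $e_\pm$ are the two edges of $f$ at $v$. The Perez–Rovelli Lorentzian Barrett–Crane partition function is $$\mathcal Z_\Delta=\int_{(0,\infty)^F}\Big(\prod_{e}\Theta_4\big((p_f)_{f\ni e}\big)\Big)\Big(\prod_v\mathcal A_v(p)\Big)\prod_f p_f^2\,dp_f,\qquad \mathcal A_v(p)=\int_{(H_+^3)^4}\prod_{f\ni v}K_{p_f}(x_{(e_+,v)},x_{(e_-,v)})\prod_{e\ni v,\,e\neq e_0^v}dx_{(e,v)},$$ and its face-factored form is $$\int_{(0,\infty)^E}\prod_e dr_e\int\prod_v\prod_{e\ni v,\,e\ne e_0^v}dx_{(e,v)}\ \prod_e\frac{2}{\pi\sinh^2 r_e}\ \prod_v\prod_{f\ni v}\frac1{\sinh\phi^f_v}\ \prod_f\int_0^\infty F_f\,dp_f,\qquad F_f=\frac{\prod_{v\in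 f}\sin(p_f\phi^f_v)\prod_{e\in f}\sin(p_fr_e)}{p_f^{\deg_V(f)+\deg_E(f)-2}} .$$ Theorem 3.1. Suppose that $\deg_V(f)\ge2$ and $\deg_E(f)\ge2$ for every face $f$, and that every edge $e$ is contained in at least one face $f$ with $\deg_V(f)+\deg_E(f)>4$. Then: 1. The face-factored form is absolutely integrable. That is, for all values of the $x_{(e,v)}$ and $r_e$ every $F_f$ is integrable in $p_f\in(0,\infty)$; the function $$\prod_e\frac{2}{\pi\sinh^2 r_e}\ \prod_v\prod_{f\ni v}\frac1{\sinh\phi^f_v}\ \prod_f\int_0^\infty|F_f|\,dp_f$$ of the variables $r_e$ and $x_{(e,v)}$ is integrable, and so is the integrand of the face-factored form; and the function $\prod_e\frac{2}{\pi\sinh^2 r_e}\prod_v\prod_{f\ni v}\frac1{\sinh\phi^f_v}\prod_f F_f$ is integrable jointly in all the variables $r_e$, $x_{(e,v)}$ and $p_f$. 2. The original partition function is finite. That is, for all $p\in(0,\infty)^F$ the integrals defining the $\Theta_4$ and the $\mathcal A_v(p)$ converge absolutely, and the integrand of $\mathcal Z_\Delta$ is integrable on $(0,\infty)^F$. 3.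 The face-factored form equals $\mathcal Z_\Delta$. -/

import Mathlib

open MeasureTheory Set

namespace BarrettCrane

noncomputable section

/-! ### The future hyperboloid -/

/-- The Minkowski inner product of signature `(+,-,-,-)` on `ℝ⁴`. -/
def mink (x y : Fin 4 → ℝ) : ℝ := x 0 * y 0 - x 1 * y 1 - x 2 * y 2 - x 3 * y 3

/-- The future hyperboloid `H₊³ = {x ∈ ℝ⁴ | x · x = 1, x₀ > 0}`. -/
def H3 : Set (Fin 4 → ℝ) := {x | mink x x = 1 ∧ 0 < x 0}

/-- The hyperbolic distance `φ(x, y) = cosh⁻¹ (x · y)` on `H₊³`. -/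
def hdist (x y : H3) : ℝ := Real.arcosh (mink x y)

/-- The global chart `ℝ³ → H₊³`, `y ↦ (√(1 + |y|²), y)`. -/
def liftH3 (y : Fin 3 → ℝ) : H3 :=
  ⟨![Real.sqrt (1 + (y 0 ^ 2 + y 1 ^ 2 + y 2 ^ 2)), y 0, y 1, y 2], by
    have h : (0 : ℝ) < 1 + (y 0 ^ 2 + y 1 ^ 2 + y 2 ^ 2) := by positivity
    have hs := Real.mul_self_sqrt h.le
    refine ⟨?_, ?_⟩
    · simp only [mink, Matrix.cons_val]
      linarith
    · simpa using Real.sqrt_pos.2 h⟩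

theorem measurable_liftH3 : Measurable liftH3 := by
  refine Measurable.subtype_mk (measurable_pi_lambda _ fun i => ?_)
  fin_cases i <;> simp <;> fun_prop

/-- The Lorentz-invariant volume measure `dx = d³y / x₀` on `H₊³`, that is, the Riemannian volume
of hyperbolic 3-space, in the chart `liftH3`. -/
def hypVol : Measure H3 :=
  ((volume : Measure (Fin 3 → ℝ)).withDensity
    (fun y => ENNReal.ofReal (1 / Real.sqrt (1 + (y 0 ^ 2 + y 1 ^ 2 + y 2 ^ 2))))).map liftH3

/-! ### Closed dual 2-complexes -/

/-- A closed dual 2-complex with vertex set `V` and edge set `E`, presented by the gluing of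
4-simplices to which it is dual.

The elements of `V` are 4-simplices, each with vertices labelled by `Fin 5`; the tetrahedron `(v, i)`
is the one of `v` opposite to its vertex `i`.  An element `e` of `E` identifies two tetrahedra
`ends (e, false)` and `ends (e, true)`; every tetrahedron of every 4-simplex is used exactly once, so
there is no boundary.  If these are `(v, i)` and `(w, j)`, the vertex `i.succAbove m` of the first
tetrahedron is identified with the vertex `j.succAbove (glue e m)` of the second one.

No regularity is imposed: two 4-simplices may share several tetrahedra. -/
structure DualComplex (V E : Type*) where
  ends : E × Bool ≃ V × Fin 5
  glue : E → Equiv.Perm (Fin 4)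

/-- The unordered pairs of distinct tetrahedra of a 4-simplex, written in increasing order; there are
ten of them. -/
abbrev TetPair : Type := {q : Fin 5 × Fin 5 // q.1 < q.2}

/-- The triangles of the individual 4-simplices, `(v, {i, j})` being the triangle of `v` shared by its
tetrahedra `i` and `j`.  In the dual picture these are the corners of the dual faces, i.e. the
incidences `f ∋ v`, and `(v, i)`, `(v, j)` are the two dual edges `e₊(f, v)`, `e₋(f, v)` at that
corner. -/
abbrev Corner (V : Type*) : Type _ := V × TetPair

/-- The pair `{i, k}` of distinct tetrahedra. -/
def tetPair (i k : Fin 5) (h : i ≠ k) : TetPair := ⟨(min i k, max i k), min_lt_max.2 h⟩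

namespace DualComplex

variable {V E : Type*} (Δ : DualComplex V E)

/-- The `m`-th triangle of the tetrahedron dual to `e` (the triangle opposite to its `m`-th vertex),
seen in the 4-simplex at the end `false` of `e`. -/
def sourceCorner (e : E) (m : Fin 4) : Corner V :=
  ((Δ.ends (e, false)).1,
    tetPair (Δ.ends (e, false)).2 ((Δ.ends (e, false)).2.succAbove m) (Fin.succAbove_ne _ _).symm)

/-- The same triangle seen in the 4-simplex at the end `true` of `e`. -/
def targetCorner (e : E) (m : Fin 4) : Corner V :=
  ((Δ.ends (e, true)).1,
    tetPair (Δ.ends (e, true)).2 ((Δ.ends (e, true)).2.succAbove (Δ.glue e m))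
      (Fin.succAbove_ne _ _).symm)

/-- The set `F` of dual faces: the triangles of the glued complex, i.e. the classes of triangles of
4-simplices under the identifications made by the tetrahedra. -/
def Face : Type _ := Quot fun c d : Corner V => ∃ e m, c = Δ.sourceCorner e m ∧ d = Δ.targetCorner e m

/-- The dual face to which a corner belongs. -/
def cornerFace (c : Corner V) : Δ.Face := Quot.mk _ c

/-- The four dual faces containing the dual edge `e`. -/
def edgeFace (e : E) (m : Fin 4) : Δ.Face := Δ.cornerFace (Δ.sourceCorner e m)

/-- `f ∋ e`. -/
def EdgeMem (e : E) (f : Δ.Face) : Prop := ∃ m, Δ.edgeFace e m = f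

instance [Finite V] : Finite Δ.Face :=
  inferInstanceAs (Finite (Quot _))

instance [Finite V] : Fintype Δ.Face := Fintype.ofFinite _

variable [Fintype V] [Fintype E]

open scoped Classical in
/-- The vertices of the polygon `f`. -/
def corners (f : Δ.Face) : Finset (Corner V) := {c | Δ.cornerFace c = f}

open scoped Classical in
/-- The edges of the polygon `f`; the pair `(e, m)` stands for `e` seen as a side of the `m`-th of the
four faces at `e`. -/
def sides (f : Δ.Face) : Finset (E × Fin 4) := {s | Δ.edgeFace s.1 s.2 = f}

/-- The number of vertices of the polygon `f`. -/
def degV (f : Δ.Face) : ℕ := (Δ.corners f).card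

/-- The number of edges of the polygon `f`. -/
def degE (f : Δ.Face) : ℕ := (Δ.sides f).card

end DualComplex

/-! ### The amplitudes of the Perez-Rovelli model -/

/-- The kernel `K_p(x, y) = sin (p φ(x, y)) / (p sinh φ(x, y))`. -/
def kernel (p : ℝ) (x y : H3) : ℝ := Real.sin (p * hdist x y) / (p * Real.sinh (hdist x y))

/-- The integrand of the eye diagram. -/
def eyeIntegrand (p₁ p₂ p₃ p₄ r : ℝ) : ℝ :=
  Real.sin (p₁ * r) * Real.sin (p₂ * r) * Real.sin (p₃ * r) * Real.sin (p₄ * r) / Real.sinh r ^ 2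

/-- The eye diagram `Θ₄`. -/
def eye (p₁ p₂ p₃ p₄ : ℝ) : ℝ :=
  2 / (Real.pi * p₁ * p₂ * p₃ * p₄) * ∫ r in Ioi (0 : ℝ), eyeIntegrand p₁ p₂ p₃ p₄ r

/-- The five hyperboloid variables at a vertex: the one with index `i₀` is fixed to be `b`, and `y`
lists the other four. -/
def hypVar (i₀ : Fin 5) (b : H3) (y : Fin 4 → H3) : Fin 5 → H3 :=
  Fin.insertNth (α := fun _ => H3) i₀ b y

/-- The measure `∏ dx_(e,v)` over the four free hyperboloid variables of one vertex. -/
def vertexMeasure : Measure (Fin 4 → H3) := Measure.pi fun _ => hypVol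

/-- Lebesgue measure on `(0, ∞)^ι`. -/
def posMeasure (ι : Type*) [Fintype ι] : Measure (ι → ℝ) :=
  Measure.pi fun _ => (volume : Measure ℝ).restrict (Ioi 0)

namespace DualComplex

variable {V E : Type*} [Fintype V] [Fintype E] (Δ : DualComplex V E)

/-- The face amplitude `𝒜_f = 1`. -/
def faceAmplitude (_p : Δ.Face → ℝ) (_f : Δ.Face) : ℝ := 1

/-- The edge amplitude `𝒜_e = Θ₄` of the spins of the four faces containing `e`. -/
def edgeAmplitude (p : Δ.Face → ℝ) (e : E) : ℝ :=
  eye (p (Δ.edgeFace e 0)) (p (Δ.edgeFace e 1)) (p (Δ.edgeFace e 2)) (p (Δ.edgeFace e 3))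

/-- The integrand of the vertex amplitude at `v`: a product of ten kernels, one for each corner of a
face at `v`, as a function of the five hyperboloid variables at `v`. -/
def vertexIntegrand (p : Δ.Face → ℝ) (v : V) (x : Fin 5 → H3) : ℝ :=
  ∏ q : TetPair, kernel (p (Δ.cornerFace (v, q))) (x q.1.1) (x q.1.2)

/-- The regularized vertex amplitude `𝒜_v`: the variable of the edge `e₀ v` at `v` is fixed to the
value `x₀ v` and not integrated. -/
def vertexAmplitude (e₀ : V → Fin 5) (x₀ : V → H3) (p : Δ.Face → ℝ) (v : V) : ℝ :=
  ∫ y, Δ.vertexIntegrand p v (hypVar (e₀ v) (x₀ v) y) ∂vertexMeasure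

/-- The integrand of the original form of the partition function. -/
def originalIntegrand (e₀ : V → Fin 5) (x₀ : V → H3) (p : Δ.Face → ℝ) : ℝ :=
  (∏ f, Δ.faceAmplitude p f) * (∏ e, Δ.edgeAmplitude p e) * (∏ v, Δ.vertexAmplitude e₀ x₀ p v) *
    ∏ f, p f ^ 2

/-- The partition function `𝒵_Δ` in its original form. -/
def partitionFunction (e₀ : V → Fin 5) (x₀ : V → H3) : ℝ :=
  ∫ p, Δ.originalIntegrand e₀ x₀ p ∂posMeasure Δ.Face

/-! ### The face-factored form -/

/-- The measure over all free hyperboloid variables `x_(e,v)`. -/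
def hypMeasure (V : Type*) [Fintype V] : Measure (V → Fin 4 → H3) := Measure.pi fun _ => vertexMeasure

/-- The distance variable `φ` of a corner, as a function of the free hyperboloid variables. -/
def phi (e₀ : V → Fin 5) (x₀ : V → H3) (y : V → Fin 4 → H3) (c : Corner V) : ℝ :=
  hdist (hypVar (e₀ c.1) (x₀ c.1) (y c.1) c.2.1.1) (hypVar (e₀ c.1) (x₀ c.1) (y c.1) c.2.1.2)

/-- The face factor `F_f(p, φ, r)`; the measure factor `p²` is included. -/
def faceFactor (φ : Corner V → ℝ) (r : E → ℝ) (f : Δ.Face) (p : ℝ) : ℝ :=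
  ((∏ c ∈ Δ.corners f, Real.sin (p * φ c)) * ∏ s ∈ Δ.sides f, Real.sin (p * r s.1)) /
    p ^ ((Δ.degV f : ℤ) + (Δ.degE f : ℤ) - 2)

/-- The factors `∏_e 2 / (π sinh² r_e) ∏_v ∏_{f ∋ v} 1 / sinh φ`. -/
def sinhFactor (φ : Corner V → ℝ) (r : E → ℝ) : ℝ :=
  (∏ e, 2 / (Real.pi * Real.sinh (r e) ^ 2)) * ∏ v : V, ∏ q : TetPair, 1 / Real.sinh (φ (v, q))

/-- The integrand of the face-factored form, a function of the `r_e` and the `x_(e,v)` in which the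
spins have been integrated out. -/
def faceFactoredIntegrand (e₀ : V → Fin 5) (x₀ : V → H3) (r : E → ℝ) (y : V → Fin 4 → H3) : ℝ :=
  sinhFactor (phi e₀ x₀ y) r * ∏ f, ∫ p in Ioi (0 : ℝ), Δ.faceFactor (phi e₀ x₀ y) r f p

/-- The partition function in its face-factored form. -/
def faceFactoredPartitionFunction (e₀ : V → Fin 5) (x₀ : V → H3) : ℝ :=
  ∫ r, ∫ y, Δ.faceFactoredIntegrand e₀ x₀ r y ∂hypMeasure V ∂posMeasure E

/-- The full integrand of the face-factored form, a function of all variables `r_e`, `x_(e,v)` and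
`p_f`. -/
def fullIntegrand (e₀ : V → Fin 5) (x₀ : V → H3)
    (z : (E → ℝ) × (V → Fin 4 → H3) × (Δ.Face → ℝ)) : ℝ :=
  sinhFactor (phi e₀ x₀ z.2.1) z.1 * ∏ f, Δ.faceFactor (phi e₀ x₀ z.2.1) z.1 f (z.2.2 f)

/-- The absolute bound of the face-factored integrand, with the absolute value taken inside the spin
integrals. -/
def absIntegrand (e₀ : V → Fin 5) (x₀ : V → H3) (z : (E → ℝ) × (V → Fin 4 → H3)) : ℝ :=
  |sinhFactor (phi e₀ x₀ z.2) z.1| *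
    ∏ f, ∫ p in Ioi (0 : ℝ), |Δ.faceFactor (phi e₀ x₀ z.2) z.1 f p|

end DualComplex

end

end BarrettCrane

open BarrettCrane

namespace BarrettCrane

/-! ### Boosts of the hyperboloid -/

/-! One pointwise bound separates the variables of the full integrand; Fubini does the rest.

In a face factor, use `|sin (p x)| ≤ p |x|` throughout when `p ≤ 1`: the powers of `p` leave `p ^ 2
≤ 1`. When `p > 1`, use `|sin| ≤ 1` at the corners and `|sin (p r)| ≤ |p r| ^ (3/8)` at the sides:
the power of `p` left is `2 - degV - (5/8) degE`, at most `-5/4` since both degrees are at least 2.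
So `abs_faceFactor_le` bounds the factor by an integrable function of `p` times a product over
corners and sides. The product of these bounds over all faces, with the `sinh` factors, is up to a
constant a product over edges and vertices, `totalWeight`.

An edge lies on four faces and contributes `(r + r ^ (3/8)) ^ 4 / sinh r ^ 2`, which is integrable.
In place of `3/8` any exponent `a` with `1/4 < a < 1/2` would serve: `4 a - 2 > -1` gives
convergence at `r = 0`, and `2 (1 - a) > 1` convergence at `p = ∞`.

A vertex contributes the product of `(1 + φ) / sinh φ` over the ten pairs of five points, one of
them fixed. By the inequality of the means this is at most a sum over the five stars of K₅, with
each weight raised to the power `5/2` (`prod_tetPair_le_sum_star`). That power is integrable over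
the hyperboloid: `5/2` is below the dimension 3, for the singularity, and above the growth rate 2 of
the volume, for the decay. A star is a tree, so it is integrated leaf by leaf; the integral over a
leaf does not depend on the centre, because the boosts preserve the volume and act transitively.

Hence the full integrand is jointly integrable. Integrating out the spins gives the face-factored
form, integrating out the other variables gives the original one. -/

theorem mink_comm (x y : Fin 4 → ℝ) : mink x y = mink y x := by
  simp only [mink]; ring

theorem hdist_comm (x y : H3) : hdist x y = hdist y x := by
  simp only [hdist, mink_comm]

theorem measurable_arcosh : Measurable Real.arcosh := by
  unfold Real.arcosh
  fun_prop

theorem measurable_coord (k : Fin 4) : Measurable fun x : H3 => x.1 k :=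
  (measurable_pi_apply k).comp measurable_subtype_coe

theorem measurable_mink : Measurable fun z : H3 × H3 => mink z.1 z.2 := by
  have h (k : Fin 4) : Measurable fun z : H3 × H3 => z.1.1 k * z.2.1 k :=
    ((measurable_coord k).comp measurable_fst).mul ((measurable_coord k).comp measurable_snd)
  exact (((h 0).sub (h 1)).sub (h 2)).sub (h 3)

theorem measurable_hdist : Measurable fun z : H3 × H3 => hdist z.1 z.2 :=
  measurable_arcosh.comp measurable_mink

/-- The chart `liftH3` as a measurable equivalence. -/
noncomputable def liftEquiv : (Fin 3 → ℝ) ≃ᵐ H3 where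
  toFun := liftH3
  invFun x k := x.1 k.succ
  left_inv y := by
    funext k
    fin_cases k <;> simp [liftH3]
  right_inv x := by
    obtain ⟨x, hx, h0⟩ := x
    apply Subtype.ext
    have h : Real.sqrt (1 + (x 1 ^ 2 + x 2 ^ 2 + x 3 ^ 2)) = x 0 := by
      rw [Real.sqrt_eq_iff_mul_self_eq (by positivity) h0.le]
      simp only [mink] at hx
      linarith
    funext k
    fin_cases k <;> simp [liftH3]
    exact h
  measurable_toFun := measurable_liftH3
  measurable_invFun := by
    exact measurable_pi_lambda _ fun k => measurable_coord k.succ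

theorem hypVol_eq : hypVol = ((volume : Measure (Fin 3 → ℝ)).withDensity
    (fun y => ENNReal.ofReal (1 / Real.sqrt (1 + (y 0 ^ 2 + y 1 ^ 2 + y 2 ^ 2))))).map liftEquiv :=
  rfl

theorem measurable_hypDensity : Measurable fun y : Fin 3 → ℝ =>
    ENNReal.ofReal (1 / Real.sqrt (1 + (y 0 ^ 2 + y 1 ^ 2 + y 2 ^ 2))) := by
  fun_prop

instance : SigmaFinite hypVol := by
  have : SigmaFinite ((volume : Measure (Fin 3 → ℝ)).withDensity
      (fun y => ENNReal.ofReal (1 / Real.sqrt (1 + (y 0 ^ 2 + y 1 ^ 2 + y 2 ^ 2))))) :=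
    SigmaFinite.withDensity_ofReal _
  rw [hypVol_eq]
  exact MeasurableEquiv.sigmaFinite_map _

theorem lintegral_hypVol {F : H3 → ENNReal} (hF : Measurable F) :
    ∫⁻ x, F x ∂hypVol = ∫⁻ y : Fin 3 → ℝ,
      ENNReal.ofReal (1 / Real.sqrt (1 + (y 0 ^ 2 + y 1 ^ 2 + y 2 ^ 2))) * F (liftH3 y) := by
  rw [hypVol, lintegral_map hF measurable_liftH3]
  exact lintegral_withDensity_eq_lintegral_mul _ measurable_hypDensity (hF.comp measurable_liftH3)

theorem abs_coord_lt (x : H3) (i : Fin 3) : |x.1 i.succ| < x.1 0 := by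
  obtain ⟨x, hx, h0⟩ := x
  simp only [mink] at hx
  apply abs_lt_of_sq_lt_sq _ h0.le
  fin_cases i <;> simp <;> nlinarith [sq_nonneg (x 1), sq_nonneg (x 2), sq_nonneg (x 3)]

/-- The boost `x₀ ↦ c x₀ + s xᵢ`, `xᵢ ↦ s x₀ + c xᵢ` with `c = √(1 + s²)`, as a map of `ℝ⁴`. -/
noncomputable def boostFun (i : Fin 3) (s : ℝ) (x : Fin 4 → ℝ) : Fin 4 → ℝ :=
  Fin.cons (Real.sqrt (1 + s ^ 2) * x 0 + s * x i.succ)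
    (Function.update (fun k => x k.succ) i (s * x 0 + Real.sqrt (1 + s ^ 2) * x i.succ))

theorem mink_eq_sum (x y : Fin 4 → ℝ) : mink x y = x 0 * y 0 - ∑ k : Fin 3, x k.succ * y k.succ := by
  simp [mink, Fin.sum_univ_three]
  ring

theorem mink_boostFun (i : Fin 3) (s : ℝ) (x y : Fin 4 → ℝ) :
    mink (boostFun i s x) (boostFun i s y) = mink x y := by
  have hc : Real.sqrt (1 + s ^ 2) ^ 2 = 1 + s ^ 2 := Real.sq_sqrt (by positivity)
  simp only [mink_eq_sum, boostFun, Fin.cons_zero, Fin.cons_succ]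
  rw [← Finset.add_sum_erase _ _ (Finset.mem_univ i),
    ← Finset.add_sum_erase (Finset.univ) (fun k : Fin 3 => x k.succ * y k.succ) (Finset.mem_univ i)]
  have : ∀ k ∈ Finset.univ.erase i, Function.update (fun k => x k.succ) i
      (s * x 0 + Real.sqrt (1 + s ^ 2) * x i.succ) k * Function.update (fun k => y k.succ) i
      (s * y 0 + Real.sqrt (1 + s ^ 2) * y i.succ) k = x k.succ * y k.succ := by
    intro k hk
    rw [Function.update_of_ne (Finset.ne_of_mem_erase hk),
      Function.update_of_ne (Finset.ne_of_mem_erase hk)]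
  rw [Finset.sum_congr rfl this]
  simp only [Function.update_self]
  linear_combination (x 0 * y 0 - x i.succ * y i.succ) * hc

theorem boostFun_neg (i : Fin 3) (s : ℝ) (x : Fin 4 → ℝ) :
    boostFun i (-s) (boostFun i s x) = x := by
  have hc : Real.sqrt (1 + s ^ 2) ^ 2 = 1 + s ^ 2 := Real.sq_sqrt (by positivity)
  funext k
  refine Fin.cases ?_ (fun k => ?_) k
  · simp only [boostFun, Fin.cons_zero, Fin.cons_succ, Function.update_self, neg_sq]
    linear_combination x 0 * hc
  · by_cases hk : k = i
    · subst hk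
      simp only [boostFun, Fin.cons_zero, Fin.cons_succ, Function.update_self, neg_sq]
      linear_combination x k.succ * hc
    · simp [boostFun, hk]

theorem boostFun_mem (i : Fin 3) (s : ℝ) (x : H3) : boostFun i s x.1 ∈ H3 := by
  refine ⟨by rw [mink_boostFun]; exact x.2.1, ?_⟩
  have h1 := abs_coord_lt x i
  have h2 : |s| < Real.sqrt (1 + s ^ 2) := by
    rw [← Real.sqrt_sq_eq_abs]
    exact Real.sqrt_lt_sqrt (by positivity) (by linarith)
  have h3 : |s| * |x.1 i.succ| ≤ |s| * x.1 0 := mul_le_mul_of_nonneg_left h1.le (abs_nonneg _)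
  have h4 : |s| * x.1 0 < Real.sqrt (1 + s ^ 2) * x.1 0 := mul_lt_mul_of_pos_right h2 x.2.2
  have h5 := neg_abs_le (s * x.1 i.succ)
  rw [abs_mul] at h5
  simp only [boostFun, Fin.cons_zero]
  linarith

theorem measurable_boostFun (i : Fin 3) (s : ℝ) : Measurable (boostFun i s) := by
  refine measurable_pi_lambda _ fun k => ?_
  refine Fin.cases ?_ (fun k => ?_) k
  · simp only [boostFun, Fin.cons_zero]
    fun_prop
  · by_cases hk : k = i
    · subst hk
      simp only [boostFun, Fin.cons_succ, Function.update_self]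
      fun_prop
    · simp only [boostFun, Fin.cons_succ, Function.update_of_ne hk]
      fun_prop

/-- The boost with parameter `s` along the axis `i`, as a transformation of the hyperboloid. -/
noncomputable def boost (i : Fin 3) (s : ℝ) : H3 ≃ᵐ H3 where
  toFun x := ⟨boostFun i s x, boostFun_mem i s x⟩
  invFun x := ⟨boostFun i (-s) x, boostFun_mem i (-s) x⟩
  left_inv x := Subtype.ext (boostFun_neg i s x)
  right_inv x := Subtype.ext (by simpa using boostFun_neg i (-s) x)
  measurable_toFun :=
    ((measurable_boostFun i s).comp measurable_subtype_coe).subtype_mk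
  measurable_invFun :=
    ((measurable_boostFun i (-s)).comp measurable_subtype_coe).subtype_mk

theorem coe_boost (i : Fin 3) (s : ℝ) (x : H3) : (boost i s x : Fin 4 → ℝ) = boostFun i s x := rfl

/-! ### Invariance of the volume under boosts -/

/-- The measure `dt / √(M + t²)` is invariant under boosts of the hyperbola `x₀² - t² = M`. The
substitution `t' = s x₀ + c t` sends `x₀` to `x₀' = c x₀ + s t` and has derivative `x₀' / x₀`, which
cancels the change of density; its inverse is the same map with `-s`. -/
theorem lintegral_boost_line {M : ℝ} (hM : 0 < M) (s : ℝ) (H : ℝ → ENNReal) :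
    ∫⁻ t, ENNReal.ofReal (1 / Real.sqrt (M + t ^ 2)) *
        H (s * Real.sqrt (M + t ^ 2) + Real.sqrt (1 + s ^ 2) * t) =
      ∫⁻ t, ENNReal.ofReal (1 / Real.sqrt (M + t ^ 2)) * H t := by
  set c := Real.sqrt (1 + s ^ 2) with hc
  have hc2 : c ^ 2 = 1 + s ^ 2 := Real.sq_sqrt (by positivity)
  have hc0 : 0 < c := Real.sqrt_pos.2 (by positivity)
  have hsc : |s| < c := by
    rw [← Real.sqrt_sq_eq_abs]
    exact Real.sqrt_lt_sqrt (by positivity) (by linarith)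
  have hw : ∀ t : ℝ, 0 < Real.sqrt (M + t ^ 2) := fun t => Real.sqrt_pos.2 (by positivity)
  have hw2 : ∀ t : ℝ, Real.sqrt (M + t ^ 2) ^ 2 = M + t ^ 2 := fun t => Real.sq_sqrt (by positivity)
  have hpos : ∀ u t : ℝ, |u| < c → 0 < c * Real.sqrt (M + t ^ 2) + u * t := by
    intro u t hu
    have h1 : |t| ≤ Real.sqrt (M + t ^ 2) := by
      rw [← Real.sqrt_sq_eq_abs]
      exact Real.sqrt_le_sqrt (by linarith)
    have h2 := neg_abs_le (u * t)
    rw [abs_mul] at h2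
    have h3 : |u| * |t| ≤ |u| * Real.sqrt (M + t ^ 2) := mul_le_mul_of_nonneg_left h1 (abs_nonneg _)
    have h4 := mul_lt_mul_of_pos_right hu (hw t)
    linarith
  have key : ∀ u t : ℝ, |u| < c → u ^ 2 = s ^ 2 →
      Real.sqrt (M + (u * Real.sqrt (M + t ^ 2) + c * t) ^ 2) = c * Real.sqrt (M + t ^ 2) + u * t := by
    intro u t hu hus
    rw [Real.sqrt_eq_iff_mul_self_eq (by positivity) (hpos u t hu).le]
    have := hw2 t
    linear_combination -((c ^ 2 - u ^ 2) * this + M * hc2 - M * hus)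
  set f : ℝ → ℝ := fun t => s * Real.sqrt (M + t ^ 2) + c * t with hf
  have hinv : ∀ u t : ℝ, |u| < c → u ^ 2 = s ^ 2 →
      -u * Real.sqrt (M + (u * Real.sqrt (M + t ^ 2) + c * t) ^ 2) +
        c * (u * Real.sqrt (M + t ^ 2) + c * t) = t := by
    intro u t hu hus
    rw [key u t hu hus]
    linear_combination t * hc2 - t * hus
  have hinj : InjOn f univ := by
    have : Function.LeftInverse (fun t => -s * Real.sqrt (M + t ^ 2) + c * t) f :=
      fun t => hinv s t hsc rfl
    exact this.injective.injOn
  have hsurj : f '' univ = univ := by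
    rw [image_univ, range_eq_univ]
    intro t
    refine ⟨-s * Real.sqrt (M + t ^ 2) + c * t, ?_⟩
    simpa using hinv (-s) t (by simpa using hsc) (by ring)
  have hderiv : ∀ t ∈ univ, HasDerivWithinAt f (s * (t / Real.sqrt (M + t ^ 2)) + c) univ t := by
    intro t _
    have h1 : HasDerivAt (fun t : ℝ => M + t ^ 2) (2 * t) t := by
      simpa using ((hasDerivAt_id t).pow 2).const_add M
    have h2 := h1.sqrt (by positivity)
    have h3 := (h2.const_mul s).add ((hasDerivAt_id t).const_mul c)
    refine (h3.congr_deriv ?_).hasDerivWithinAt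
    field_simp
  have := lintegral_image_eq_lintegral_abs_deriv_mul MeasurableSet.univ hderiv hinj
    (fun t => ENNReal.ofReal (1 / Real.sqrt (M + t ^ 2)) * H t)
  rw [hsurj, Measure.restrict_univ] at this
  rw [this]
  refine lintegral_congr fun t => ?_
  rw [← mul_assoc, ← ENNReal.ofReal_mul (abs_nonneg _)]
  congr 2
  have hp := hpos s t hsc
  have e : s * (t / Real.sqrt (M + t ^ 2)) + c =
      (c * Real.sqrt (M + t ^ 2) + s * t) / Real.sqrt (M + t ^ 2) := by
    have := hw t
    field_simp
    ring
  simp only [hf]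
  rw [key s t hsc rfl, e, abs_of_pos (div_pos hp (hw t))]
  have := hw t
  rw [div_mul_div_comm, mul_one, mul_comm (Real.sqrt _) (_ + _), ← div_div, div_self hp.ne']

/-- In the chart a boost moves only the coordinate `i`. With the other two frozen in `M = 1 + ∑
z_k²`, Tonelli reduces the claim to `lintegral_boost_line`. -/
theorem measurePreserving_boost (i : Fin 3) (s : ℝ) : MeasurePreserving (boost i s) hypVol hypVol := by
  refine ⟨(boost i s).measurable, ?_⟩
  refine Measure.ext_of_lintegral _ fun F hF => ?_
  have hFb := lintegral_hypVol (hF.comp (boost i s).measurable)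
  rw [lintegral_map hF (boost i s).measurable, lintegral_hypVol hF]
  refine hFb.trans ?_
  have hmp := (volume_preserving_piFinSuccAbove (fun _ : Fin 3 => ℝ) i).symm
  have hnorm : ∀ (t : ℝ) (z : Fin 2 → ℝ),
      (1 + ((i.insertNth t z : Fin 3 → ℝ) 0 ^ 2 + (i.insertNth t z : Fin 3 → ℝ) 1 ^ 2 +
        (i.insertNth t z : Fin 3 → ℝ) 2 ^ 2)) = (1 + ∑ k, z k ^ 2) + t ^ 2 := by
    intro t z
    have := Fin.sum_univ_succAbove (fun k => (i.insertNth t z : Fin 3 → ℝ) k ^ 2) i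
    simp only [Fin.insertNth_apply_same, Fin.insertNth_apply_succAbove] at this
    rw [Fin.sum_univ_three] at this
    linarith
  have hb : ∀ (t : ℝ) (z : Fin 2 → ℝ), boost i s (liftH3 (i.insertNth t z)) =
      liftH3 (i.insertNth (s * Real.sqrt ((1 + ∑ k, z k ^ 2) + t ^ 2) + Real.sqrt (1 + s ^ 2) * t) z) := by
    intro t z
    apply liftEquiv.symm.injective
    funext k
    change boostFun i s (liftH3 (i.insertNth t z)) k.succ = (liftEquiv.symm (liftEquiv _)) k
    have h0 : (liftH3 (i.insertNth t z)).1 0 = Real.sqrt ((1 + ∑ k, z k ^ 2) + t ^ 2) := by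
      rw [← hnorm]; rfl
    have hk : ∀ k : Fin 3, (liftH3 (i.insertNth t z)).1 k.succ = (i.insertNth t z : Fin 3 → ℝ) k :=
      fun k => congrFun (liftEquiv.symm_apply_apply (i.insertNth t z)) k
    rw [MeasurableEquiv.symm_apply_apply]
    simp only [boostFun, Fin.cons_succ, h0, hk]
    refine Fin.succAboveCases i ?_ (fun j => ?_) k
    · simp
    · simp
  rw [← hmp.lintegral_comp (by
      exact measurable_hypDensity.mul ((hF.comp (boost i s).measurable).comp measurable_liftH3)),
    ← hmp.lintegral_comp (by exact measurable_hypDensity.mul (hF.comp measurable_liftH3))]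
  change ∫⁻ a : ℝ × (Fin 2 → ℝ), _ ∂(volume.prod volume) = ∫⁻ a : ℝ × (Fin 2 → ℝ), _ ∂(volume.prod volume)
  have hms := (MeasurableEquiv.piFinSuccAbove (fun _ : Fin 3 => ℝ) i).symm.measurable
  refine (lintegral_prod_symm _ ((measurable_hypDensity.mul
    ((hF.comp (boost i s).measurable).comp measurable_liftH3)).comp hms).aemeasurable).trans
    (Eq.trans ?_ (lintegral_prod_symm _ ((measurable_hypDensity.mul
      (hF.comp measurable_liftH3)).comp hms).aemeasurable).symm)
  refine lintegral_congr fun z => ?_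
  have hd : ∀ t : ℝ, ENNReal.ofReal (1 / Real.sqrt (1 + ((i.insertNth t z : Fin 3 → ℝ) 0 ^ 2 +
      (i.insertNth t z : Fin 3 → ℝ) 1 ^ 2 + (i.insertNth t z : Fin 3 → ℝ) 2 ^ 2))) =
      ENNReal.ofReal (1 / Real.sqrt ((1 + ∑ k, z k ^ 2) + t ^ 2)) := fun t => by rw [hnorm]
  refine (lintegral_congr fun t => congrArg₂ (· * ·) (hd t) (congrArg F (hb t z))).trans
    (Eq.trans ?_ (lintegral_congr fun t => congrArg₂ (· * ·) (hd t) rfl).symm)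
  exact lintegral_boost_line (M := 1 + ∑ k, z k ^ 2) (by positivity) s
    (fun t => F (liftH3 (i.insertNth t z)))

/-- The base point `(1, 0, 0, 0)` of the hyperboloid. -/
noncomputable def origin : H3 := liftH3 0

theorem exists_boost_coord_eq_zero (x : H3) (i : Fin 3) : ∃ s, (boost i s x).1 i.succ = 0 ∧
    ∀ k ≠ i, (boost i s x).1 k.succ = x.1 k.succ := by
  have h := abs_coord_lt x i
  have hd : 0 < x.1 0 ^ 2 - x.1 i.succ ^ 2 := by
    have := sq_lt_sq' (by linarith [abs_nonneg (x.1 i.succ)]) h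
    rw [sq_abs] at this
    linarith
  have hr := Real.sqrt_pos.2 hd
  have hr2 := Real.sq_sqrt hd.le
  -- This `s` solves `s x₀ + √(1 + s²) xᵢ = 0`.
  refine ⟨-x.1 i.succ / Real.sqrt (x.1 0 ^ 2 - x.1 i.succ ^ 2), ?_, fun k hk => ?_⟩
  · have hc : Real.sqrt (1 + (-x.1 i.succ / Real.sqrt (x.1 0 ^ 2 - x.1 i.succ ^ 2)) ^ 2) =
        x.1 0 / Real.sqrt (x.1 0 ^ 2 - x.1 i.succ ^ 2) := by
      rw [Real.sqrt_eq_iff_mul_self_eq (by positivity) (div_nonneg x.2.2.le hr.le)]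
      field_simp
      linear_combination hr2
    rw [coe_boost]
    simp only [boostFun, Fin.cons_succ, Function.update_self, hc]
    ring
  · rw [coe_boost]
    simp [boostFun, hk]

/-- The isometry group generated by boosts acts transitively on the hyperboloid. -/
theorem exists_measurePreserving_eq_origin (x : H3) : ∃ T : H3 ≃ᵐ H3,
    MeasurePreserving T hypVol hypVol ∧ (∀ a b : H3, hdist (T a) (T b) = hdist a b) ∧
      T x = origin := by
  have hd : ∀ i s (a b : H3), hdist (boost i s a) (boost i s b) = hdist a b := fun i s a b => by
    simp only [hdist, coe_boost, mink_boostFun]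
  obtain ⟨s₀, h₀, -⟩ := exists_boost_coord_eq_zero x 0
  obtain ⟨s₁, h₁, h₁'⟩ := exists_boost_coord_eq_zero (boost 0 s₀ x) 1
  obtain ⟨s₂, h₂, h₂'⟩ := exists_boost_coord_eq_zero (boost 1 s₁ (boost 0 s₀ x)) 2
  refine ⟨((boost 0 s₀).trans (boost 1 s₁)).trans (boost 2 s₂), ?_, fun a b => ?_, ?_⟩
  · exact ((measurePreserving_boost 0 s₀).trans (measurePreserving_boost 1 s₁)).trans
      (measurePreserving_boost 2 s₂)
  · simp only [MeasurableEquiv.trans_apply, hd]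
  · apply liftEquiv.symm.injective
    funext k
    rw [show liftEquiv.symm origin = 0 from liftEquiv.symm_apply_apply 0]
    change (boost 2 s₂ (boost 1 s₁ (boost 0 s₀ x))).1 k.succ = 0
    -- Coordinates already made zero stay zero, since each later boost acts on another axis.
    fin_cases k
    · exact (h₂' 0 (by decide)).trans ((h₁' 0 (by decide)).trans h₀)
    · exact (h₂' 1 (by decide)).trans h₁
    · exact h₂

/-! ### Integrability on the half-line -/

theorem integrableOn_Ioi_of_rpow_bounds {f : ℝ → ℝ} (hf : Measurable f) {A B a b : ℝ} (ha : -1 < a)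
    (hb : b < -1) (h₀ : ∀ r, 0 < r → r ≤ 1 → |f r| ≤ A * r ^ a)
    (h₁ : ∀ r, 1 < r → |f r| ≤ B * r ^ b) : IntegrableOn f (Ioi 0) := by
  rw [← Ioc_union_Ioi_eq_Ioi (zero_le_one' ℝ)]
  refine IntegrableOn.union ?_ ?_
  · have h : IntegrableOn (fun r : ℝ => A * r ^ a) (Ioc 0 1) := by
      rw [← intervalIntegrable_iff_integrableOn_Ioc_of_le zero_le_one]
      exact (intervalIntegral.intervalIntegrable_rpow' ha).const_mul A
    refine Integrable.mono' h hf.aestronglyMeasurable ?_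
    filter_upwards [ae_restrict_mem measurableSet_Ioc] with r hr
    exact h₀ r hr.1 hr.2
  · have h : IntegrableOn (fun r : ℝ => B * r ^ b) (Ioi 1) :=
      (integrableOn_Ioi_rpow_of_lt hb zero_lt_one).const_mul B
    refine Integrable.mono' h hf.aestronglyMeasurable ?_
    filter_upwards [ae_restrict_mem measurableSet_Ioi] with r hr
    exact h₁ r hr

/-- The factor by which an edge variable enters the bound of a face factor. -/
noncomputable def sideWeight (r : ℝ) : ℝ := |r| + |r| ^ (3 / 8 : ℝ)

theorem sideWeight_nonneg (r : ℝ) : 0 ≤ sideWeight r := by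
  unfold sideWeight; positivity

theorem measurable_sideWeight : Measurable sideWeight := by
  unfold sideWeight; fun_prop

/-- The bound of the total weight of an edge variable: it enters four faces. -/
noncomputable def edgeWeight (r : ℝ) : ℝ := sideWeight r ^ 4 / Real.sinh r ^ 2

theorem measurable_edgeWeight : Measurable edgeWeight := by
  unfold edgeWeight
  exact (measurable_sideWeight.pow_const 4).div (by fun_prop)

/-- Keep the cubic Taylor term of `exp r` and use `exp (-r) ≤ 1`. A cube is what is needed: squared,
it beats the fourth power in `edgeWeight` by `r ^ 2`. -/
theorem cube_div_le_sinh {r : ℝ} (hr : 0 ≤ r) : r ^ 3 / 12 ≤ Real.sinh r := by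
  have h1 := Real.sum_le_exp_of_nonneg hr 4
  have h2 : Real.exp (-r) ≤ 1 := Real.exp_le_one_iff.2 (by linarith)
  simp only [Finset.sum_range_succ, Finset.sum_range_zero, Nat.factorial] at h1
  rw [Real.sinh_eq]
  norm_num at h1
  nlinarith [sq_nonneg r]

theorem integrableOn_edgeWeight : IntegrableOn edgeWeight (Ioi 0) := by
  -- Near 0 the exponent is `4 * (3/8) - 2 = -1/2`; at infinity it is `4 - 6 = -2`.
  refine integrableOn_Ioi_of_rpow_bounds measurable_edgeWeight (A := 16) (B := 16 * 144)
    (a := -1 / 2) (b := -2) (by norm_num) (by norm_num) (fun r hr hr1 => ?_) (fun r hr => ?_)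
  · have hs : r ≤ Real.sinh r := Real.self_le_sinh_iff.2 hr.le
    have h1 : sideWeight r ≤ 2 * r ^ (3 / 8 : ℝ) := by
      have : r ^ (1 : ℝ) ≤ r ^ (3 / 8 : ℝ) := Real.rpow_le_rpow_of_exponent_ge hr hr1 (by norm_num)
      rw [Real.rpow_one] at this
      rw [sideWeight, abs_of_pos hr]
      linarith
    rw [edgeWeight, abs_of_nonneg (by positivity)]
    calc sideWeight r ^ 4 / Real.sinh r ^ 2 ≤ (2 * r ^ (3 / 8 : ℝ)) ^ 4 / r ^ 2 := by
          have := sideWeight_nonneg r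
          gcongr
      _ = 16 * r ^ (-1 / 2 : ℝ) := by
          rw [mul_pow, ← Real.rpow_natCast, ← Real.rpow_natCast, ← Real.rpow_natCast,
            ← Real.rpow_mul hr.le, mul_div_assoc, ← Real.rpow_sub hr]
          norm_num
  · have hr0 : 0 < r := by linarith
    have hs := cube_div_le_sinh hr0.le
    have h1 : sideWeight r ≤ 2 * r := by
      have : r ^ (3 / 8 : ℝ) ≤ r ^ (1 : ℝ) := Real.rpow_le_rpow_of_exponent_le hr.le (by norm_num)
      rw [Real.rpow_one] at this
      rw [sideWeight, abs_of_pos hr0]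
      linarith
    rw [edgeWeight, abs_of_nonneg (by positivity)]
    calc sideWeight r ^ 4 / Real.sinh r ^ 2 ≤ (2 * r) ^ 4 / (r ^ 3 / 12) ^ 2 := by
          have := sideWeight_nonneg r
          gcongr
      _ = 16 * 144 * r ^ (-2 : ℝ) := by
          rw [Real.rpow_neg hr0.le, Real.rpow_ofNat]
          field_simp
          norm_num

/-! ### The weight of a corner -/

/-- The bound of the factor which depends on the distance variable of a corner. -/
noncomputable def cornerWeight (φ : ℝ) : ℝ := (1 + |φ|) / |Real.sinh φ|

theorem cornerWeight_nonneg (φ : ℝ) : 0 ≤ cornerWeight φ := by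
  unfold cornerWeight; positivity

theorem measurable_cornerWeight : Measurable cornerWeight := by
  unfold cornerWeight
  fun_prop

/-- The weight of an edge of a star. -/
noncomputable def starWeight (x y : H3) : ℝ := cornerWeight (hdist x y) ^ (5 / 2 : ℝ)

theorem starWeight_nonneg (x y : H3) : 0 ≤ starWeight x y :=
  Real.rpow_nonneg (cornerWeight_nonneg _) _

theorem starWeight_comm (x y : H3) : starWeight x y = starWeight y x := by
  rw [starWeight, hdist_comm, starWeight]

theorem _root_.Measurable.starWeight {α : Type*} [MeasurableSpace α] {f g : α → H3}
    (hf : Measurable f) (hg : Measurable g) : Measurable fun a => starWeight (f a) (g a) :=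
  have h : Measurable fun a => hdist (f a) (g a) := measurable_hdist.comp (hf.prodMk hg)
  (measurable_cornerWeight.comp h).pow_const _

/-- Trades the linear factor for a slow exponential. After the power `5/2` it costs only `exp (φ /
4)`, so the decay `exp (-9 φ / 4)` still beats the volume growth `exp (2 φ)`. -/
theorem one_add_le_exp (x : ℝ) : 1 + x ≤ 10 * Real.exp (x / 10) := by
  have := Real.add_one_le_exp (x / 10)
  linarith

theorem hdist_liftH3_origin (z : Fin 3 → ℝ) :
    hdist (liftH3 z) origin = Real.arcosh (Real.sqrt (1 + (z 0 ^ 2 + z 1 ^ 2 + z 2 ^ 2))) := by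
  simp [hdist, mink, liftH3, origin]

/-- With `q` the Euclidean norm squared, `cosh φ = √(1 + q)` and `sinh φ = √q`, and `N ≤ √q ≤ √3 N`
for the sup norm `N`. The bound is therefore radial in `N`. -/
theorem starWeight_origin_le (z : Fin 3 → ℝ) :
    1 / Real.sqrt (1 + (z 0 ^ 2 + z 1 ^ 2 + z 2 ^ 2)) * starWeight (liftH3 z) origin ≤
      10 ^ (5 / 2 : ℝ) * 4 * ((1 + ‖z‖ ^ 2) ^ (-3 / 8 : ℝ) * ‖z‖ ^ (-5 / 2 : ℝ)) := by
  set q := z 0 ^ 2 + z 1 ^ 2 + z 2 ^ 2 with hq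
  have hq0 : 0 ≤ q := by positivity
  set N := ‖z‖ with hN
  have hNk : ∀ k, z k ^ 2 ≤ N ^ 2 := fun k => sq_le_sq' (neg_le_of_abs_le (norm_le_pi_norm z k))
    ((le_abs_self _).trans (norm_le_pi_norm z k))
  have hqN : q ≤ 3 * N ^ 2 := by linarith [hNk 0, hNk 1, hNk 2]
  have hNq : N ≤ Real.sqrt q := by
    refine (pi_norm_le_iff_of_nonneg (Real.sqrt_nonneg _)).2 fun k => ?_
    rw [Real.norm_eq_abs]
    refine Real.abs_le_sqrt ?_
    fin_cases k <;> simp [hq] <;> nlinarith [sq_nonneg (z 0), sq_nonneg (z 1), sq_nonneg (z 2)]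
  have hN0 : 0 ≤ N := norm_nonneg _
  have h1 : 1 ≤ Real.sqrt (1 + q) := Real.one_le_sqrt.2 (by linarith)
  have hs : Real.sqrt (Real.sqrt (1 + q) ^ 2 - 1) = Real.sqrt q := by
    rw [Real.sq_sqrt (by positivity)]; congr 1; ring
  rw [starWeight, hdist_liftH3_origin, ← hq, cornerWeight, Real.sinh_arcosh h1, hs,
    abs_of_nonneg (Real.arcosh_nonneg h1), abs_of_nonneg (Real.sqrt_nonneg _)]
  -- At the origin itself the left side is 0, by the convention for division by zero.
  rcases hN0.eq_or_lt with hN0 | hN0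
  · have : q = 0 := le_antisymm (by rw [← hN0] at hqN; linarith) hq0
    rw [this, Real.sqrt_zero, div_zero, Real.zero_rpow (by norm_num), mul_zero]
    positivity
  -- Here `exp φ = cosh φ + sinh φ ≤ 2 √(1 + q) ≤ 4 √(1 + N²)`.
  have hE : 1 + Real.arcosh (Real.sqrt (1 + q)) ≤ 10 * (4 * Real.sqrt (1 + N ^ 2)) ^ (1 / 10 : ℝ) := by
    refine (one_add_le_exp _).trans ?_
    rw [div_eq_mul_one_div, Real.exp_mul, Real.exp_arcosh h1, hs]
    have h2 : Real.sqrt (1 + q) ≤ 2 * Real.sqrt (1 + N ^ 2) := by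
      rw [Real.sqrt_le_left (by positivity), mul_pow, Real.sq_sqrt (by positivity)]
      linarith
    have h3 : Real.sqrt q ≤ Real.sqrt (1 + q) := Real.sqrt_le_sqrt (by linarith)
    gcongr
    linarith
  have hA : 0 ≤ Real.arcosh (Real.sqrt (1 + q)) := Real.arcosh_nonneg h1
  have hM : (0 : ℝ) < 1 + N ^ 2 := by positivity
  calc 1 / Real.sqrt (1 + q) * ((1 + Real.arcosh (Real.sqrt (1 + q))) / Real.sqrt q) ^ (5 / 2 : ℝ)
      ≤ 1 / Real.sqrt (1 + N ^ 2) *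
        (10 * (4 * Real.sqrt (1 + N ^ 2)) ^ (1 / 10 : ℝ) / N) ^ (5 / 2 : ℝ) := by
        have : N ^ 2 ≤ q := by
          rw [← Real.sq_sqrt hq0]
          gcongr
        gcongr
    _ = 10 ^ (5 / 2 : ℝ) * 4 ^ (1 / 4 : ℝ) * ((1 + N ^ 2) ^ (-3 / 8 : ℝ) * N ^ (-5 / 2 : ℝ)) := by
        rw [Real.div_rpow (by positivity) hN0.le, Real.mul_rpow (by norm_num) (by positivity),
          ← Real.rpow_mul (by positivity), Real.mul_rpow (by norm_num) (by positivity),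
          Real.sqrt_eq_rpow, ← Real.rpow_mul hM.le, show (-5 / 2 : ℝ) = -(5 / 2) by norm_num,
          Real.rpow_neg hN0.le, one_div, ← Real.rpow_neg hM.le,
          show (-3 / 8 : ℝ) = -(1 / 2) + 1 / 2 * (1 / 10 * (5 / 2)) by norm_num, Real.rpow_add hM]
        norm_num
        ring
    _ ≤ _ := by
        gcongr
        calc (4 : ℝ) ^ (1 / 4 : ℝ) ≤ 4 ^ (1 : ℝ) :=
              Real.rpow_le_rpow_of_exponent_le (by norm_num) (by norm_num)
          _ = 4 := Real.rpow_one 4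

/-- With the radial Jacobian `N ^ 2` the integrand behaves as `N ^ (-1/2)` at 0 and as `N ^ (-5/4)`
at infinity. -/
theorem integrable_radial_bound : Integrable fun z : Fin 3 → ℝ =>
    (1 + ‖z‖ ^ 2) ^ (-3 / 8 : ℝ) * ‖z‖ ^ (-5 / 2 : ℝ) := by
  rw [integrable_fun_norm_addHaar volume
    (f := fun N => (1 + N ^ 2) ^ (-3 / 8 : ℝ) * N ^ (-5 / 2 : ℝ))]
  simp only [Module.finrank_fin_fun, smul_eq_mul]
  have key : ∀ r : ℝ, 0 < r → |r ^ (3 - 1) * ((1 + r ^ 2) ^ (-3 / 8 : ℝ) * r ^ (-5 / 2 : ℝ))| =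
      (1 + r ^ 2) ^ (-3 / 8 : ℝ) * r ^ (-1 / 2 : ℝ) := by
    intro r hr
    rw [abs_of_nonneg (by positivity), show (-1 / 2 : ℝ) = ((2 : ℕ) : ℝ) + -5 / 2 by norm_num,
      Real.rpow_add hr, Real.rpow_natCast]
    ring
  refine integrableOn_Ioi_of_rpow_bounds (by fun_prop) (A := 1) (B := 1)
    (a := -1 / 2) (b := -5 / 4) (by norm_num) (by norm_num) (fun r hr hr1 => ?_) (fun r hr => ?_)
  · rw [key r hr]
    gcongr
    exact Real.rpow_le_one_of_one_le_of_nonpos (by nlinarith) (by norm_num)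
  · have hr0 : 0 < r := by linarith
    rw [key r hr0]
    have : (1 + r ^ 2) ^ (-3 / 8 : ℝ) ≤ (r ^ 2) ^ (-3 / 8 : ℝ) :=
      Real.rpow_le_rpow_of_nonpos (by positivity) (by linarith) (by norm_num)
    calc _ ≤ (r ^ 2) ^ (-3 / 8 : ℝ) * r ^ (-1 / 2 : ℝ) := by gcongr
      _ = _ := by
        rw [← Real.rpow_natCast, ← Real.rpow_mul hr0.le, ← Real.rpow_add hr0]
        norm_num

theorem integrable_starWeight_origin : Integrable (fun x => starWeight x origin) hypVol := by
  have hm : Measurable fun x => starWeight x origin :=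
    measurable_id.starWeight measurable_const
  refine ⟨hm.aestronglyMeasurable, ?_⟩
  rw [hasFiniteIntegral_iff_ofReal (Filter.Eventually.of_forall fun x => starWeight_nonneg _ _),
    lintegral_hypVol hm.ennreal_ofReal]
  have hb := (integrable_radial_bound.const_mul (10 ^ (5 / 2 : ℝ) * 4)).lintegral_lt_top
  refine lt_of_le_of_lt (lintegral_mono fun z => ?_) hb
  rw [← ENNReal.ofReal_mul (by positivity)]
  exact ENNReal.ofReal_le_ofReal (starWeight_origin_le z)

/-- The integral of `starWeight` over the hyperboloid. -/
noncomputable def starMass : ℝ := ∫ x, starWeight x origin ∂hypVol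

/-- Homogeneity: moving `y` to the origin by an isometry makes both the integrability and the
integral of the weight independent of `y`. -/
theorem starWeight_eq_comp (y : H3) : ∃ T : H3 ≃ᵐ H3, MeasurePreserving T hypVol hypVol ∧
    (fun x => starWeight x y) = (fun x => starWeight x origin) ∘ T := by
  obtain ⟨T, hT, hd, hy⟩ := exists_measurePreserving_eq_origin y
  refine ⟨T, hT, funext fun x => ?_⟩
  simp only [starWeight, Function.comp_apply, ← hy, hd]

theorem integrable_starWeight (y : H3) : Integrable (fun x => starWeight x y) hypVol := by
  obtain ⟨T, hT, he⟩ := starWeight_eq_comp y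
  rw [he]
  exact (hT.integrable_comp_emb T.measurableEmbedding).2 integrable_starWeight_origin

theorem integral_starWeight (y : H3) : ∫ x, starWeight x y ∂hypVol = starMass := by
  obtain ⟨T, hT, he⟩ := starWeight_eq_comp y
  rw [he]
  exact hT.integral_comp T.measurableEmbedding (fun x => starWeight x origin)

/-! ### The integral at a vertex -/

theorem prod_tetPair {M : Type*} [CommMonoid M] (f : Fin 5 × Fin 5 → M) :
    ∏ q : TetPair, f q.1 = ∏ i, ∏ j, if i < j then f (i, j) else 1 := by
  rw [← Fintype.prod_prod_type' (fun i j => if i < j then f (i, j) else 1), ← Finset.prod_filter]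
  exact (Finset.prod_subtype _ (by simp) f).symm

/-- Each unordered pair occurs in the double product once from either end. -/
theorem prod_tetPair_mul_self {M : Type*} [CommMonoid M] (b : Fin 5 → Fin 5 → M)
    (hb : ∀ i j, b i j = b j i) :
    ∏ q : TetPair, b q.1.1 q.1.2 * b q.1.1 q.1.2 = ∏ i, ∏ j, if j = i then 1 else b i j := by
  have h : ∀ i j, (if j = i then 1 else b i j) =
      (if i < j then b i j else 1) * if j < i then b j i else 1 := by
    intro i j
    rcases lt_trichotomy i j with h | h | h
    · simp [h, h.ne', h.not_gt]
    · simp [h]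
    · simp [h, h.ne, h.not_gt, hb i j]
  simp only [h, Finset.prod_mul_distrib]
  rw [prod_tetPair fun z => b z.1 z.2]
  congr 1
  exact Finset.prod_comm

/-- Every edge of K₅ lies in exactly two of its five stars, so the geometric mean of the star
products of `c ^ (5/2)` carries each edge with exponent `2 * (1/5) * (5/2) = 1`. Now apply the
weighted inequality of the means. -/
theorem prod_tetPair_le_sum_star (c : Fin 5 → Fin 5 → ℝ) (h0 : ∀ i j, 0 ≤ c i j)
    (hc : ∀ i j, c i j = c j i) :
    ∏ q : TetPair, c q.1.1 q.1.2 ≤ ∑ i, ∏ j, if j = i then 1 else c i j ^ (5 / 2 : ℝ) := by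
  have hz : ∀ i, 0 ≤ ∏ j, if j = i then (1 : ℝ) else c i j ^ (5 / 2 : ℝ) := fun i =>
    Finset.prod_nonneg fun j _ => by
      split_ifs
      · exact zero_le_one
      · exact Real.rpow_nonneg (h0 _ _) _
  have h := Real.geom_mean_le_arith_mean_weighted Finset.univ (fun _ : Fin 5 => (1 / 5 : ℝ))
    (fun i => ∏ j, if j = i then 1 else c i j ^ (5 / 2 : ℝ)) (by simp) (by simp) (fun i _ => hz i)
  have e : ∀ i, (∏ j, if j = i then (1 : ℝ) else c i j ^ (5 / 2 : ℝ)) ^ (1 / 5 : ℝ) =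
      ∏ j, if j = i then 1 else Real.sqrt (c i j) := by
    intro i
    rw [← Real.finsetProd_rpow]
    · refine Finset.prod_congr rfl fun j _ => ?_
      split_ifs
      · exact Real.one_rpow _
      · rw [← Real.rpow_mul (h0 _ _), Real.sqrt_eq_rpow]
        norm_num
    · intro j _
      split_ifs
      · exact zero_le_one
      · exact Real.rpow_nonneg (h0 _ _) _
  simp only [e] at h
  refine le_trans (le_of_eq ?_) (h.trans ?_)
  · rw [← prod_tetPair_mul_self (fun i j => Real.sqrt (c i j)) fun i j => by rw [hc]]
    exact Finset.prod_congr rfl fun q _ => (Real.mul_self_sqrt (h0 _ _)).symm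
  · refine Finset.sum_le_sum fun i _ => ?_
    have := hz i
    linarith

theorem measurable_hypVar (i₀ : Fin 5) (b : H3) (i : Fin 5) :
    Measurable fun y : Fin 4 → H3 => hypVar i₀ b y i := by
  refine Fin.succAboveCases i₀ ?_ (fun k => ?_) i
  · simp [hypVar]
  · simpa [hypVar] using measurable_pi_apply k

theorem integrable_star (i₀ : Fin 5) (b : H3) (i : Fin 5) :
    Integrable (fun y => ∏ j, if j = i then 1 else starWeight (hypVar i₀ b y i) (hypVar i₀ b y j))
      vertexMeasure := by
  refine Fin.succAboveCases i₀ ?_ (fun k => ?_) i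
  -- Centre at the fixed point: the four leaves are independent.
  · have : (fun y => ∏ j, if j = i₀ then 1 else
        starWeight (hypVar i₀ b y i₀) (hypVar i₀ b y j)) =
        fun y : Fin 4 → H3 => ∏ k, starWeight (y k) b := by
      funext y
      rw [Fin.prod_univ_succAbove _ i₀]
      simp [hypVar, Fin.succAbove_ne, starWeight_comm b]
    rw [this]
    exact Integrable.fintype_prod fun _ => integrable_starWeight b
  -- Centre at a free point: the three free leaves are integrated first, giving `starMass ^ 3`
  -- whatever the centre; then the centre is integrated against the remaining edge to `b`.
  · have : (fun y => ∏ j, if j = i₀.succAbove k then 1 else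
        starWeight (hypVar i₀ b y (i₀.succAbove k)) (hypVar i₀ b y j)) =
        (fun z : H3 × (Fin 3 → H3) => starWeight z.1 b * ∏ m, starWeight (z.2 m) z.1) ∘
          MeasurableEquiv.piFinSuccAbove (fun _ => H3) k := by
      funext y
      rw [Fin.prod_univ_succAbove _ i₀, Fin.prod_univ_succAbove _ k]
      simp [hypVar, Fin.succAbove_ne, (Fin.succAbove_ne _ _).symm, starWeight_comm (y k) (y _),
        MeasurableEquiv.piFinSuccAbove_apply, Fin.removeNth]
    rw [this, vertexMeasure]
    refine ((measurePreserving_piFinSuccAbove (fun _ => hypVol) k).integrable_comp_emb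
      (MeasurableEquiv.measurableEmbedding _)).2 ?_
    have hm : Measurable fun z : H3 × (Fin 3 → H3) =>
        starWeight z.1 b * ∏ m, starWeight (z.2 m) z.1 :=
      (measurable_fst.starWeight measurable_const).mul
        (Finset.measurable_prod _ fun m _ =>
          ((measurable_pi_apply m).comp measurable_snd).starWeight measurable_fst)
    refine (integrable_prod_iff hm.aestronglyMeasurable).2 ⟨.of_forall fun x => ?_, ?_⟩
    · have h : Integrable (fun z : Fin 3 → H3 => ∏ m, starWeight (z m) x)
          (Measure.pi fun _ => hypVol) := Integrable.fintype_prod fun _ => integrable_starWeight x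
      exact h.const_mul (starWeight x b)
    · have : (fun x : H3 => ∫ z : Fin 3 → H3, ‖starWeight x b * ∏ m, starWeight (z m) x‖
          ∂Measure.pi fun _ => hypVol) = fun x => starWeight x b * starMass ^ 3 := by
        funext x
        have hn : ∀ z : Fin 3 → H3, ‖starWeight x b * ∏ m, starWeight (z m) x‖ =
            starWeight x b * ∏ m, starWeight (z m) x := fun z =>
          Real.norm_of_nonneg (mul_nonneg (starWeight_nonneg _ _)
            (Finset.prod_nonneg fun m _ => starWeight_nonneg _ _))
        simp only [hn]
        rw [integral_const_mul, integral_fintype_prod_eq_pow (fun z => starWeight z x),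
          integral_starWeight]
        simp
      rw [this]
      exact (integrable_starWeight b).mul_const _

/-- The product over the corners at a vertex of `cornerWeight` is integrable: it is at most a sum of
weights of stars, by the inequality of the means. -/
theorem integrable_prod_cornerWeight (i₀ : Fin 5) (b : H3) :
    Integrable (fun y => ∏ q : TetPair,
      cornerWeight (hdist (hypVar i₀ b y q.1.1) (hypVar i₀ b y q.1.2))) vertexMeasure := by
  refine Integrable.mono' (integrable_finsetSum Finset.univ fun i _ => integrable_star i₀ b i) ?_
    (.of_forall fun y => ?_)
  · refine (Finset.measurable_prod _ fun q _ => measurable_cornerWeight.comp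
      (measurable_hdist.comp ((measurable_hypVar i₀ b _).prodMk
        (measurable_hypVar i₀ b _)))).aestronglyMeasurable
  · rw [Real.norm_of_nonneg (Finset.prod_nonneg fun q _ => cornerWeight_nonneg _)]
    exact prod_tetPair_le_sum_star (fun i j => cornerWeight (hdist (hypVar i₀ b y i) (hypVar i₀ b y j)))
      (fun _ _ => cornerWeight_nonneg _) (fun i j => by rw [hdist_comm])

/-! ### Bounds of the sines and convergence of the amplitudes -/

theorem abs_sin_mul_le_sideWeight {p : ℝ} (hp : 0 ≤ p) (r : ℝ) :
    |Real.sin (p * r)| ≤ p * sideWeight r := by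
  refine Real.abs_sin_le_abs.trans ?_
  rw [abs_mul, abs_of_nonneg hp]
  have : 0 ≤ |r| ^ (3 / 8 : ℝ) := by positivity
  exact mul_le_mul_of_nonneg_left (by unfold sideWeight; linarith) hp

/-- Interpolates between `|sin x| ≤ |x|` and `|sin x| ≤ 1`. -/
theorem abs_sin_le_rpow (x : ℝ) : |Real.sin x| ≤ |x| ^ (3 / 8 : ℝ) := by
  rcases le_total |x| 1 with h | h
  · rcases (abs_nonneg x).eq_or_lt with h0 | h0
    · have : x = 0 := abs_eq_zero.1 h0.symm
      simp [this]
    · refine Real.abs_sin_le_abs.trans ?_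
      simpa using Real.rpow_le_rpow_of_exponent_ge h0 h (by norm_num : (3 / 8 : ℝ) ≤ 1)
  · exact (Real.abs_sin_le_one x).trans (Real.one_le_rpow h (by norm_num))

theorem abs_sin_mul_le_rpow_mul_sideWeight {p : ℝ} (hp : 0 ≤ p) (r : ℝ) :
    |Real.sin (p * r)| ≤ p ^ (3 / 8 : ℝ) * sideWeight r := by
  refine (abs_sin_le_rpow _).trans ?_
  rw [abs_mul, abs_of_nonneg hp, Real.mul_rpow hp (abs_nonneg _)]
  have := abs_nonneg r
  exact mul_le_mul_of_nonneg_left (by unfold sideWeight; linarith) (by positivity)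

/-- The spin dependence of the bound of a face factor. -/
noncomputable def spinWeight (p : ℝ) : ℝ := if p ≤ 1 then 1 else p ^ (-5 / 4 : ℝ)

theorem integrableOn_spinWeight : IntegrableOn spinWeight (Ioi 0) := by
  have hm : Measurable spinWeight := by
    unfold spinWeight
    exact Measurable.ite measurableSet_Iic measurable_const (by fun_prop)
  refine integrableOn_Ioi_of_rpow_bounds hm (A := 1) (B := 1) (a := 0) (b := -5 / 4)
    (by norm_num) (by norm_num) (fun r _ hr => ?_) (fun r hr => ?_)
  · simp [spinWeight, hr]
  · have : 0 < r := by linarith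
    rw [spinWeight, if_neg hr.not_ge, abs_of_nonneg (by positivity), one_mul]

instance (ι : Type*) [Fintype ι] : SigmaFinite (posMeasure ι) := by
  unfold posMeasure; infer_instance

instance : SigmaFinite vertexMeasure := by
  unfold vertexMeasure; infer_instance

theorem ae_posMeasure (ι : Type*) [Fintype ι] : ∀ᵐ p ∂posMeasure ι, ∀ i, 0 < p i := by
  rw [posMeasure, ← Measure.restrict_pi_pi]
  filter_upwards [ae_restrict_mem (MeasurableSet.univ_pi fun _ => measurableSet_Ioi)] with p hp i
  exact hp i (mem_univ i)

theorem abs_eyeIntegrand_le {p₁ p₂ p₃ p₄ : ℝ} (h₁ : 0 ≤ p₁) (h₂ : 0 ≤ p₂) (h₃ : 0 ≤ p₃)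
    (h₄ : 0 ≤ p₄) (r : ℝ) :
    |eyeIntegrand p₁ p₂ p₃ p₄ r| ≤ p₁ * p₂ * p₃ * p₄ * edgeWeight r := by
  have hs := sideWeight_nonneg r
  rw [eyeIntegrand, abs_div, abs_mul, abs_mul, abs_mul, abs_of_nonneg (sq_nonneg (Real.sinh r))]
  calc _ ≤ (p₁ * sideWeight r) * (p₂ * sideWeight r) * (p₃ * sideWeight r) * (p₄ * sideWeight r) /
        Real.sinh r ^ 2 := by
        gcongr <;> exact abs_sin_mul_le_sideWeight ‹_› r
    _ = _ := by rw [edgeWeight]; ring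

theorem integrableOn_eyeIntegrand {p₁ p₂ p₃ p₄ : ℝ} (h₁ : 0 ≤ p₁) (h₂ : 0 ≤ p₂) (h₃ : 0 ≤ p₃)
    (h₄ : 0 ≤ p₄) : IntegrableOn (eyeIntegrand p₁ p₂ p₃ p₄) (Ioi 0) := by
  have hm : Measurable (eyeIntegrand p₁ p₂ p₃ p₄) := by
    unfold eyeIntegrand
    fun_prop
  exact Integrable.mono' (integrableOn_edgeWeight.const_mul (p₁ * p₂ * p₃ * p₄))
    hm.aestronglyMeasurable (.of_forall fun r => abs_eyeIntegrand_le h₁ h₂ h₃ h₄ r)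

/-- For a single vertex amplitude the spins are constants, so the blow-up of `1 / p` at 0 is
harmless. -/
theorem abs_kernel_le {p : ℝ} (hp : 0 < p) (x y : H3) :
    |kernel p x y| ≤ 1 / p * cornerWeight (hdist x y) := by
  have h1 : |Real.sin (p * hdist x y)| ≤ 1 + |hdist x y| :=
    (Real.abs_sin_le_one _).trans (by linarith [abs_nonneg (hdist x y)])
  rw [kernel, abs_div, abs_mul, abs_of_pos hp, cornerWeight, div_mul_div_comm, one_mul]
  gcongr

theorem _root_.Measurable.hdist {α : Type*} [MeasurableSpace α] {f g : α → H3}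
    (hf : Measurable f) (hg : Measurable g) : Measurable fun a => hdist (f a) (g a) :=
  measurable_hdist.comp (hf.prodMk hg)

namespace DualComplex

variable {V E : Type*} (Δ : DualComplex V E)

instance [Fintype V] : SigmaFinite (hypMeasure V) := by
  unfold hypMeasure; infer_instance

theorem integrable_vertexIntegrand (e₀ : V → Fin 5) (x₀ : V → H3) {p : Δ.Face → ℝ}
    (hp : ∀ f, 0 < p f) (v : V) :
    Integrable (fun y => Δ.vertexIntegrand p v (hypVar (e₀ v) (x₀ v) y)) vertexMeasure := by
  have hm : Measurable fun y => Δ.vertexIntegrand p v (hypVar (e₀ v) (x₀ v) y) := by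
    refine Finset.measurable_prod _ fun q _ => ?_
    have := (measurable_hypVar (e₀ v) (x₀ v) q.1.1).hdist (measurable_hypVar (e₀ v) (x₀ v) q.1.2)
    unfold kernel
    fun_prop
  refine Integrable.mono' ((integrable_prod_cornerWeight (e₀ v) (x₀ v)).const_mul
    (∏ q : TetPair, 1 / p (Δ.cornerFace (v, q)))) hm.aestronglyMeasurable (.of_forall fun y => ?_)
  rw [vertexIntegrand, Real.norm_eq_abs, Finset.abs_prod, ← Finset.prod_mul_distrib]
  exact Finset.prod_le_prod (fun _ _ => abs_nonneg _) fun q _ => abs_kernel_le (hp _) _ _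

theorem measurable_phi (e₀ : V → Fin 5) (x₀ : V → H3) (c : Corner V) :
    Measurable fun y => phi e₀ x₀ y c :=
  ((measurable_hypVar _ _ _).comp (measurable_pi_apply c.1)).hdist
    ((measurable_hypVar _ _ _).comp (measurable_pi_apply c.1))

variable [Fintype V] [Fintype E]

/-! ### The bound of a face factor -/

/-- The dependence of the bound of a face factor on the distances and the edge variables. -/
noncomputable def faceWeight (φ : Corner V → ℝ) (r : E → ℝ) (f : Δ.Face) : ℝ :=
  (∏ c ∈ Δ.corners f, (1 + |φ c|)) * ∏ s ∈ Δ.sides f, sideWeight (r s.1)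

theorem faceWeight_nonneg (φ : Corner V → ℝ) (r : E → ℝ) (f : Δ.Face) : 0 ≤ Δ.faceWeight φ r f :=
  mul_nonneg (Finset.prod_nonneg fun _ _ => by positivity)
    (Finset.prod_nonneg fun _ _ => sideWeight_nonneg _)

/-- The weights `1 + |φ|` and `sideWeight` dominate both the bound used for `p ≤ 1` and the one used
for `p > 1`, so one product of weights serves for all spins. -/
theorem abs_faceFactor_le {f : Δ.Face} (hdeg : 2 ≤ Δ.degV f ∧ 2 ≤ Δ.degE f) (φ : Corner V → ℝ)
    (r : E → ℝ) {p : ℝ} (hp : 0 < p) :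
    |Δ.faceFactor φ r f p| ≤ Δ.faceWeight φ r f * spinWeight p := by
  have hS : 0 ≤ ∏ s ∈ Δ.sides f, sideWeight (r s.1) :=
    Finset.prod_nonneg fun _ _ => sideWeight_nonneg _
  have hW := Δ.faceWeight_nonneg φ r f
  rw [faceFactor, abs_div, abs_mul, Finset.abs_prod, Finset.abs_prod, abs_of_pos (zpow_pos hp _)]
  rcases le_or_gt p 1 with h | h
  · have h1 : ∏ c ∈ Δ.corners f, |Real.sin (p * φ c)| ≤
        p ^ Δ.degV f * ∏ c ∈ Δ.corners f, (1 + |φ c|) := by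
      rw [degV, ← Finset.prod_const, ← Finset.prod_mul_distrib]
      refine Finset.prod_le_prod (fun _ _ => abs_nonneg _) fun c _ => Real.abs_sin_le_abs.trans ?_
      rw [abs_mul, abs_of_pos hp]
      gcongr
      linarith
    have h2 : ∏ s ∈ Δ.sides f, |Real.sin (p * r s.1)| ≤
        p ^ Δ.degE f * ∏ s ∈ Δ.sides f, sideWeight (r s.1) := by
      rw [degE, ← Finset.prod_const, ← Finset.prod_mul_distrib]
      exact Finset.prod_le_prod (fun _ _ => abs_nonneg _) fun s _ =>
        abs_sin_mul_le_sideWeight hp.le _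
    rw [spinWeight, if_pos h, mul_one, div_le_iff₀ (zpow_pos hp _)]
    calc _ ≤ (p ^ Δ.degV f * ∏ c ∈ Δ.corners f, (1 + |φ c|)) *
          (p ^ Δ.degE f * ∏ s ∈ Δ.sides f, sideWeight (r s.1)) :=
          mul_le_mul h1 h2 (Finset.prod_nonneg fun _ _ => abs_nonneg _) (by positivity)
      _ = Δ.faceWeight φ r f * p ^ ((Δ.degV f : ℤ) + Δ.degE f) := by
          rw [zpow_add₀ hp.ne', zpow_natCast, zpow_natCast, faceWeight]
          ring
      _ ≤ _ := by
          refine mul_le_mul_of_nonneg_left ?_ hW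
          -- The denominator has two powers of `p` fewer than the numerator provides.
          exact zpow_le_zpow_right_of_le_one₀ hp h (by linarith)
  · have h1 : ∏ c ∈ Δ.corners f, |Real.sin (p * φ c)| ≤ ∏ c ∈ Δ.corners f, (1 + |φ c|) :=
      Finset.prod_le_prod (fun _ _ => abs_nonneg _) fun c _ =>
        (Real.abs_sin_le_one _).trans (by linarith [abs_nonneg (φ c)])
    have h2 : ∏ s ∈ Δ.sides f, |Real.sin (p * r s.1)| ≤
        (p ^ (3 / 8 : ℝ)) ^ Δ.degE f * ∏ s ∈ Δ.sides f, sideWeight (r s.1) := by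
      rw [degE, ← Finset.prod_const, ← Finset.prod_mul_distrib]
      exact Finset.prod_le_prod (fun _ _ => abs_nonneg _) fun s _ =>
        abs_sin_mul_le_rpow_mul_sideWeight hp.le _
    rw [spinWeight, if_neg h.not_ge, div_le_iff₀ (zpow_pos hp _)]
    calc _ ≤ (∏ c ∈ Δ.corners f, (1 + |φ c|)) *
          ((p ^ (3 / 8 : ℝ)) ^ Δ.degE f * ∏ s ∈ Δ.sides f, sideWeight (r s.1)) :=
          mul_le_mul h1 h2 (Finset.prod_nonneg fun _ _ => abs_nonneg _) (by positivity)
      _ = Δ.faceWeight φ r f * p ^ ((3 / 8 : ℝ) * Δ.degE f) := by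
          rw [Real.rpow_mul hp.le, Real.rpow_natCast, faceWeight]
          ring
      _ ≤ Δ.faceWeight φ r f * p ^ ((-5 / 4 : ℝ) + ((Δ.degV f : ℝ) + Δ.degE f - 2)) := by
          -- The exponents compare because `degV + (5/8) degE ≥ 2 + 5/4`.
          refine mul_le_mul_of_nonneg_left (Real.rpow_le_rpow_of_exponent_le h.le ?_) hW
          have hV : (2 : ℝ) ≤ Δ.degV f := by exact_mod_cast hdeg.1
          have hE : (2 : ℝ) ≤ Δ.degE f := by exact_mod_cast hdeg.2
          linarith
      _ = _ := by
          rw [Real.rpow_add hp, ← mul_assoc, ← Real.rpow_intCast]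
          push_cast
          rfl

theorem measurable_faceFactor (φ : Corner V → ℝ) (r : E → ℝ) (f : Δ.Face) :
    Measurable (Δ.faceFactor φ r f) := by
  unfold faceFactor
  fun_prop

theorem integrableOn_faceFactor {f : Δ.Face} (hdeg : 2 ≤ Δ.degV f ∧ 2 ≤ Δ.degE f)
    (φ : Corner V → ℝ) (r : E → ℝ) : IntegrableOn (Δ.faceFactor φ r f) (Ioi 0) := by
  refine Integrable.mono' (integrableOn_spinWeight.const_mul (Δ.faceWeight φ r f))
    (Δ.measurable_faceFactor φ r f).aestronglyMeasurable ?_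
  filter_upwards [ae_restrict_mem measurableSet_Ioi] with p hp
  exact Δ.abs_faceFactor_le hdeg φ r hp

theorem integral_abs_faceFactor_le {f : Δ.Face} (hdeg : 2 ≤ Δ.degV f ∧ 2 ≤ Δ.degE f)
    (φ : Corner V → ℝ) (r : E → ℝ) :
    ∫ p in Ioi (0 : ℝ), |Δ.faceFactor φ r f p| ≤
      Δ.faceWeight φ r f * ∫ p in Ioi (0 : ℝ), spinWeight p := by
  rw [← integral_const_mul]
  exact setIntegral_mono_on (Δ.integrableOn_faceFactor hdeg φ r).abs
    (integrableOn_spinWeight.const_mul _) measurableSet_Ioi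
    fun p hp => Δ.abs_faceFactor_le hdeg φ r hp

/-! ### Regrouping products by faces -/

/-- The sets `corners f` are the fibres of `cornerFace`, hence partition all corners; `prod_sides`
is the same for the pairs `(e, m)`. -/
theorem prod_corners {M : Type*} [CommMonoid M] (h : Corner V → M) :
    ∏ f, ∏ c ∈ Δ.corners f, h c = ∏ v : V, ∏ q : TetPair, h (v, q) := by
  classical
  rw [← Fintype.prod_prod_type]
  convert Finset.prod_fiberwise Finset.univ Δ.cornerFace h
  ext
  simp [corners]

theorem prod_sides {M : Type*} [CommMonoid M] (h : E × Fin 4 → M) :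
    ∏ f, ∏ s ∈ Δ.sides f, h s = ∏ e : E, ∏ m : Fin 4, h (e, m) := by
  classical
  rw [← Fintype.prod_prod_type]
  convert Finset.prod_fiberwise Finset.univ (fun s : E × Fin 4 => Δ.edgeFace s.1 s.2) h
  ext
  simp [sides]

theorem prod_faceWeight (φ : Corner V → ℝ) (r : E → ℝ) :
    ∏ f, Δ.faceWeight φ r f =
      (∏ v : V, ∏ q : TetPair, (1 + |φ (v, q)|)) * ∏ e, sideWeight (r e) ^ 4 := by
  simp only [faceWeight, Finset.prod_mul_distrib, prod_corners]
  rw [Δ.prod_sides fun s => sideWeight (r s.1)]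
  simp

/-- One power of `1 / p` goes to each corner, for its kernel, and one to each side, for its eye
diagram; the `p ^ 2` left over is the spin measure. -/
theorem faceFactor_eq (φ : Corner V → ℝ) (r : E → ℝ) {p : Δ.Face → ℝ} {f : Δ.Face} (hp : 0 < p f) :
    Δ.faceFactor φ r f (p f) =
      (∏ c ∈ Δ.corners f, Real.sin (p (Δ.cornerFace c) * φ c) / p (Δ.cornerFace c)) *
      (∏ s ∈ Δ.sides f, Real.sin (p (Δ.edgeFace s.1 s.2) * r s.1) / p (Δ.edgeFace s.1 s.2)) *
        p f ^ 2 := by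
  have h1 : ∏ c ∈ Δ.corners f, Real.sin (p (Δ.cornerFace c) * φ c) / p (Δ.cornerFace c) =
      (∏ c ∈ Δ.corners f, Real.sin (p f * φ c)) / p f ^ Δ.degV f := by
    rw [degV, ← Finset.prod_const, ← Finset.prod_div_distrib]
    refine Finset.prod_congr rfl fun c hc => ?_
    rw [show Δ.cornerFace c = f by simpa [corners] using hc]
  have h2 : ∏ s ∈ Δ.sides f, Real.sin (p (Δ.edgeFace s.1 s.2) * r s.1) / p (Δ.edgeFace s.1 s.2) =
      (∏ s ∈ Δ.sides f, Real.sin (p f * r s.1)) / p f ^ Δ.degE f := by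
    rw [degE, ← Finset.prod_const, ← Finset.prod_div_distrib]
    refine Finset.prod_congr rfl fun s hs => ?_
    rw [show Δ.edgeFace s.1 s.2 = f by simpa [sides] using hs]
  rw [h1, h2, faceFactor, zpow_sub₀ hp.ne', zpow_add₀ hp.ne', zpow_natCast, zpow_natCast]
  have := hp.ne'
  field_simp

/-- At positive spins, the integrand of the face-factored form is the product of the integrands which
define the edge and vertex amplitudes, and of the measure factors. -/
theorem fullIntegrand_eq (e₀ : V → Fin 5) (x₀ : V → H3) {p : Δ.Face → ℝ} (hp : ∀ f, 0 < p f)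
    (r : E → ℝ) (y : V → Fin 4 → H3) :
    Δ.fullIntegrand e₀ x₀ (r, y, p) =
      (∏ e, 2 / (Real.pi * p (Δ.edgeFace e 0) * p (Δ.edgeFace e 1) * p (Δ.edgeFace e 2) *
        p (Δ.edgeFace e 3)) * eyeIntegrand (p (Δ.edgeFace e 0)) (p (Δ.edgeFace e 1))
        (p (Δ.edgeFace e 2)) (p (Δ.edgeFace e 3)) (r e)) *
      (∏ v, Δ.vertexIntegrand p v (hypVar (e₀ v) (x₀ v) (y v))) * ∏ f, p f ^ 2 := by
  simp only [fullIntegrand, sinhFactor]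
  rw [Finset.prod_congr rfl fun f _ => Δ.faceFactor_eq (phi e₀ x₀ y) r (hp f)]
  simp only [Finset.prod_mul_distrib]
  rw [Δ.prod_corners fun c => Real.sin (p (Δ.cornerFace c) * phi e₀ x₀ y c) / p (Δ.cornerFace c),
    Δ.prod_sides fun s => Real.sin (p (Δ.edgeFace s.1 s.2) * r s.1) / p (Δ.edgeFace s.1 s.2)]
  have hv : ∏ v, Δ.vertexIntegrand p v (hypVar (e₀ v) (x₀ v) (y v)) =
      (∏ v : V, ∏ q : TetPair, 1 / Real.sinh (phi e₀ x₀ y (v, q))) *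
      ∏ v : V, ∏ q : TetPair, Real.sin (p (Δ.cornerFace (v, q)) * phi e₀ x₀ y (v, q)) /
        p (Δ.cornerFace (v, q)) := by
    simp only [← Finset.prod_mul_distrib, vertexIntegrand, kernel]
    refine Finset.prod_congr rfl fun v _ => Finset.prod_congr rfl fun q _ => ?_
    rw [div_mul_div_comm, one_mul, mul_comm (Real.sinh _)]
    rfl
  have he : (∏ e, 2 / (Real.pi * p (Δ.edgeFace e 0) * p (Δ.edgeFace e 1) * p (Δ.edgeFace e 2) *
        p (Δ.edgeFace e 3))) * ∏ e, eyeIntegrand (p (Δ.edgeFace e 0)) (p (Δ.edgeFace e 1))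
        (p (Δ.edgeFace e 2)) (p (Δ.edgeFace e 3)) (r e) =
      (∏ e, 2 / (Real.pi * Real.sinh (r e) ^ 2)) * ∏ e : E, ∏ m : Fin 4,
        Real.sin (p (Δ.edgeFace e m) * r e) / p (Δ.edgeFace e m) := by
    simp only [← Finset.prod_mul_distrib, eyeIntegrand, Fin.prod_univ_four]
    refine Finset.prod_congr rfl fun e _ => ?_
    rw [div_mul_div_comm, div_mul_div_comm, div_mul_div_comm, div_mul_div_comm, div_mul_div_comm]
    congr 1
    ring
  rw [hv, he]
  ring

/-! ### Integrability of the full integrand -/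

theorem measurable_fullIntegrand (e₀ : V → Fin 5) (x₀ : V → H3) :
    Measurable (Δ.fullIntegrand e₀ x₀) := by
  have hphi : ∀ c : Corner V, Measurable
      fun z : (E → ℝ) × (V → Fin 4 → H3) × (Δ.Face → ℝ) => phi e₀ x₀ z.2.1 c := fun c =>
    (measurable_phi e₀ x₀ c).comp (measurable_fst.comp measurable_snd)
  have hr : ∀ e : E, Measurable
      fun z : (E → ℝ) × (V → Fin 4 → H3) × (Δ.Face → ℝ) => z.1 e := fun e =>
    (measurable_pi_apply e).comp measurable_fst
  have hp : ∀ f, Measurable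
      fun z : (E → ℝ) × (V → Fin 4 → H3) × (Δ.Face → ℝ) => z.2.2 f := fun f =>
    (measurable_pi_apply f).comp (measurable_snd.comp measurable_snd)
  unfold fullIntegrand sinhFactor faceFactor
  fun_prop

/-- The product of the bounds of the edge and vertex factors. -/
noncomputable def totalWeight (e₀ : V → Fin 5) (x₀ : V → H3)
    (z : (E → ℝ) × (V → Fin 4 → H3)) : ℝ :=
  (∏ e, edgeWeight (z.1 e)) * ∏ v : V, ∏ q : TetPair, cornerWeight (phi e₀ x₀ z.2 (v, q))

theorem integrable_totalWeight (e₀ : V → Fin 5) (x₀ : V → H3) :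
    Integrable (totalWeight (E := E) e₀ x₀) ((posMeasure E).prod (hypMeasure V)) := by
  have h1 : Integrable (fun r : E → ℝ => ∏ e, edgeWeight (r e)) (posMeasure E) :=
    Integrable.fintype_prod fun _ => integrableOn_edgeWeight
  have h2 : Integrable (fun y : V → Fin 4 → H3 =>
      ∏ v : V, ∏ q : TetPair, cornerWeight (phi e₀ x₀ y (v, q))) (hypMeasure V) :=
    Integrable.fintype_prod (f := fun v y => ∏ q : TetPair,
      cornerWeight (hdist (hypVar (e₀ v) (x₀ v) y q.1.1) (hypVar (e₀ v) (x₀ v) y q.1.2)))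
      fun v => integrable_prod_cornerWeight (e₀ v) (x₀ v)
  exact h1.mul_prod h2

theorem absIntegrand_nonneg (e₀ : V → Fin 5) (x₀ : V → H3) (z : (E → ℝ) × (V → Fin 4 → H3)) :
    0 ≤ Δ.absIntegrand e₀ x₀ z :=
  mul_nonneg (abs_nonneg _) (Finset.prod_nonneg fun _ _ => integral_nonneg fun _ => abs_nonneg _)

theorem absIntegrand_le (hdeg : ∀ f, 2 ≤ Δ.degV f ∧ 2 ≤ Δ.degE f) (e₀ : V → Fin 5) (x₀ : V → H3)
    (z : (E → ℝ) × (V → Fin 4 → H3)) :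
    Δ.absIntegrand e₀ x₀ z ≤ ((2 / Real.pi) ^ Fintype.card E *
      (∫ p in Ioi (0 : ℝ), spinWeight p) ^ Fintype.card Δ.Face) * totalWeight e₀ x₀ z := by
  have h1 : ∏ f, ∫ p in Ioi (0 : ℝ), |Δ.faceFactor (phi e₀ x₀ z.2) z.1 f p| ≤
      ∏ f, Δ.faceWeight (phi e₀ x₀ z.2) z.1 f * ∫ p in Ioi (0 : ℝ), spinWeight p :=
    Finset.prod_le_prod (fun _ _ => integral_nonneg fun _ => abs_nonneg _)
      fun f _ => Δ.integral_abs_faceFactor_le (hdeg f) _ _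
  refine (mul_le_mul_of_nonneg_left h1 (abs_nonneg _)).trans (le_of_eq ?_)
  have h2 : |sinhFactor (phi e₀ x₀ z.2) z.1| = (2 / Real.pi) ^ Fintype.card E *
      (∏ e, 1 / Real.sinh (z.1 e) ^ 2) *
        ∏ v : V, ∏ q : TetPair, 1 / |Real.sinh (phi e₀ x₀ z.2 (v, q))| := by
    rw [sinhFactor, abs_mul, Finset.abs_prod, Finset.abs_prod, ← Finset.card_univ,
      ← Finset.prod_const, ← Finset.prod_mul_distrib]
    congr 1
    · refine Finset.prod_congr rfl fun e _ => ?_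
      rw [abs_of_nonneg (by positivity), div_mul_div_comm, mul_one]
    · refine Finset.prod_congr rfl fun v _ => ?_
      rw [Finset.abs_prod]
      simp only [abs_div, abs_one]
  rw [h2, Finset.prod_mul_distrib, prod_faceWeight, Finset.prod_const, Finset.card_univ, totalWeight]
  simp only [edgeWeight, cornerWeight, div_eq_mul_inv, one_mul, Finset.prod_mul_distrib]
  ring

theorem integrable_fiber (hdeg : ∀ f, 2 ≤ Δ.degV f ∧ 2 ≤ Δ.degE f) (e₀ : V → Fin 5) (x₀ : V → H3)
    (z : (E → ℝ) × (V → Fin 4 → H3)) :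
    Integrable (fun p => Δ.fullIntegrand e₀ x₀ (z.1, z.2, p)) (posMeasure Δ.Face) := by
  have h : Integrable (fun p : Δ.Face → ℝ => ∏ f, Δ.faceFactor (phi e₀ x₀ z.2) z.1 f (p f))
      (posMeasure Δ.Face) :=
    Integrable.fintype_prod fun f => Δ.integrableOn_faceFactor (hdeg f) _ _
  exact h.const_mul (sinhFactor (phi e₀ x₀ z.2) z.1)

theorem integral_norm_fiber (e₀ : V → Fin 5) (x₀ : V → H3) (z : (E → ℝ) × (V → Fin 4 → H3)) :
    ∫ p, ‖Δ.fullIntegrand e₀ x₀ (z.1, z.2, p)‖ ∂posMeasure Δ.Face = Δ.absIntegrand e₀ x₀ z := by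
  simp only [fullIntegrand, Real.norm_eq_abs, abs_mul, Finset.abs_prod]
  rw [integral_const_mul, posMeasure,
    integral_fintype_prod_eq_prod fun f p => |Δ.faceFactor (phi e₀ x₀ z.2) z.1 f p|]
  rfl

theorem integral_fiber (e₀ : V → Fin 5) (x₀ : V → H3) (z : (E → ℝ) × (V → Fin 4 → H3)) :
    ∫ p, Δ.fullIntegrand e₀ x₀ (z.1, z.2, p) ∂posMeasure Δ.Face =
      Δ.faceFactoredIntegrand e₀ x₀ z.1 z.2 := by
  simp only [fullIntegrand]
  rw [integral_const_mul, posMeasure,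
    integral_fintype_prod_eq_prod fun f p => Δ.faceFactor (phi e₀ x₀ z.2) z.1 f p]
  rfl

/-- Tonelli with the spins innermost: for fixed `r` and `y` the integrand is a product of functions
of single spins, and its `L¹` norm, `absIntegrand`, is dominated by a multiple of `totalWeight`. -/
theorem integrable_fullIntegrand_assoc (hdeg : ∀ f, 2 ≤ Δ.degV f ∧ 2 ≤ Δ.degE f) (e₀ : V → Fin 5)
    (x₀ : V → H3) :
    Integrable (fun w : ((E → ℝ) × (V → Fin 4 → H3)) × (Δ.Face → ℝ) =>
      Δ.fullIntegrand e₀ x₀ (w.1.1, w.1.2, w.2))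
      (((posMeasure E).prod (hypMeasure V)).prod (posMeasure Δ.Face)) := by
  have hm : AEStronglyMeasurable (fun w : ((E → ℝ) × (V → Fin 4 → H3)) × (Δ.Face → ℝ) =>
      Δ.fullIntegrand e₀ x₀ (w.1.1, w.1.2, w.2))
      (((posMeasure E).prod (hypMeasure V)).prod (posMeasure Δ.Face)) :=
    ((Δ.measurable_fullIntegrand e₀ x₀).comp
      MeasurableEquiv.prodAssoc.measurable).aestronglyMeasurable
  refine (integrable_prod_iff hm).2 ⟨.of_forall fun z => Δ.integrable_fiber hdeg e₀ x₀ z, ?_⟩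
  refine Integrable.mono' ((integrable_totalWeight e₀ x₀).const_mul
    ((2 / Real.pi) ^ Fintype.card E *
      (∫ p in Ioi (0 : ℝ), spinWeight p) ^ Fintype.card Δ.Face))
    hm.norm.integral_prod_right' (.of_forall fun z => ?_)
  · rw [Δ.integral_norm_fiber e₀ x₀ z, Real.norm_of_nonneg (Δ.absIntegrand_nonneg e₀ x₀ z)]
    exact Δ.absIntegrand_le hdeg e₀ x₀ z

/-- For fixed spins the variables of different edges and vertices separate, so the integral is a
product of amplitudes. The product formulas for Bochner integrals used here need no integrability.
-/
theorem integral_fullIntegrand_eq_originalIntegrand (e₀ : V → Fin 5) (x₀ : V → H3)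
    {p : Δ.Face → ℝ} (hp : ∀ f, 0 < p f) :
    ∫ z : (E → ℝ) × (V → Fin 4 → H3), Δ.fullIntegrand e₀ x₀ (z.1, z.2, p)
      ∂(posMeasure E).prod (hypMeasure V) = Δ.originalIntegrand e₀ x₀ p := by
  simp only [Δ.fullIntegrand_eq e₀ x₀ hp]
  rw [integral_mul_const, integral_prod_mul
    (fun r : E → ℝ => ∏ e, 2 / (Real.pi * p (Δ.edgeFace e 0) * p (Δ.edgeFace e 1) *
        p (Δ.edgeFace e 2) * p (Δ.edgeFace e 3)) * eyeIntegrand (p (Δ.edgeFace e 0))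
        (p (Δ.edgeFace e 1)) (p (Δ.edgeFace e 2)) (p (Δ.edgeFace e 3)) (r e))
    (fun y : V → Fin 4 → H3 => ∏ v, Δ.vertexIntegrand p v (hypVar (e₀ v) (x₀ v) (y v))),
    posMeasure, hypMeasure, integral_fintype_prod_eq_prod (fun e r =>
      2 / (Real.pi * p (Δ.edgeFace e 0) * p (Δ.edgeFace e 1) *
        p (Δ.edgeFace e 2) * p (Δ.edgeFace e 3)) * eyeIntegrand (p (Δ.edgeFace e 0))
        (p (Δ.edgeFace e 1)) (p (Δ.edgeFace e 2)) (p (Δ.edgeFace e 3)) r),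
    integral_fintype_prod_eq_prod
      (fun v y => Δ.vertexIntegrand p v (hypVar (e₀ v) (x₀ v) y))]
  simp only [integral_const_mul, originalIntegrand, faceAmplitude, Finset.prod_const_one, one_mul,
    edgeAmplitude, eye, vertexAmplitude]

end DualComplex

end BarrettCrane

/-! ### Conclusion by Fubini -/

theorem theorem3p1 {V E : Type*} [Fintype V] [Fintype E] (Δ : DualComplex V E)
    -- the regularization: the omitted edge at each vertex and the value of its variable
    (e₀ : V → Fin 5) (x₀ : V → H3)
    (hdeg : ∀ f, 2 ≤ Δ.degV f ∧ 2 ≤ Δ.degE f)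
    (hedge : ∀ e : E, ∃ f, Δ.EdgeMem e f ∧ 4 < Δ.degV f + Δ.degE f) :
    -- the face-factored form is absolutely integrable
    (∀ (r : E → ℝ) (y : V → Fin 4 → H3) (f : Δ.Face),
      IntegrableOn (fun p => Δ.faceFactor (DualComplex.phi e₀ x₀ y) r f p) (Ioi 0)) ∧
    Integrable (Δ.absIntegrand e₀ x₀) ((posMeasure E).prod (DualComplex.hypMeasure V)) ∧
    Integrable (fun z : (E → ℝ) × (V → Fin 4 → H3) => Δ.faceFactoredIntegrand e₀ x₀ z.1 z.2)
      ((posMeasure E).prod (DualComplex.hypMeasure V)) ∧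
    Integrable (Δ.fullIntegrand e₀ x₀)
      ((posMeasure E).prod ((DualComplex.hypMeasure V).prod (posMeasure Δ.Face))) ∧
    -- the amplitudes are given by convergent integrals and the original form is finite
    (∀ p : Δ.Face → ℝ, (∀ f, 0 < p f) →
      (∀ e, IntegrableOn (eyeIntegrand (p (Δ.edgeFace e 0)) (p (Δ.edgeFace e 1))
        (p (Δ.edgeFace e 2)) (p (Δ.edgeFace e 3))) (Ioi 0)) ∧
      ∀ v, Integrable (fun y => Δ.vertexIntegrand p v (hypVar (e₀ v) (x₀ v) y)) vertexMeasure) ∧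
    Integrable (Δ.originalIntegrand e₀ x₀) (posMeasure Δ.Face) ∧
    -- the two forms agree
    Δ.partitionFunction e₀ x₀ = Δ.faceFactoredPartitionFunction e₀ x₀ := by

  have hfull := Δ.integrable_fullIntegrand_assoc hdeg e₀ x₀
  have horig := fun (p : Δ.Face → ℝ) (hp : ∀ f, 0 < p f) =>
    Δ.integral_fullIntegrand_eq_originalIntegrand e₀ x₀ hp
  refine ⟨fun r y f => Δ.integrableOn_faceFactor (hdeg f) _ _, ?_, ?_, ?_,
    fun p hp => ⟨fun e => integrableOn_eyeIntegrand (hp _).le (hp _).le (hp _).le (hp _).le,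
      fun v => Δ.integrable_vertexIntegrand e₀ x₀ hp v⟩, ?_, ?_⟩
  · exact hfull.integral_norm_prod_left.congr
      (.of_forall fun z => Δ.integral_norm_fiber e₀ x₀ z)
  · exact hfull.integral_prod_left.congr (.of_forall fun z => Δ.integral_fiber e₀ x₀ z)
  · exact ((measurePreserving_prodAssoc (posMeasure E) (DualComplex.hypMeasure V)
      (posMeasure Δ.Face)).integrable_comp_emb (MeasurableEquiv.measurableEmbedding _)).1 hfull
  -- The marginal is identified with the original integrand only at positive spins, which is almost
  -- everywhere.
  · exact hfull.integral_prod_right.congr ((ae_posMeasure Δ.Face).mono horig)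
  · calc Δ.partitionFunction e₀ x₀
        = ∫ p, ∫ z : (E → ℝ) × (V → Fin 4 → H3), Δ.fullIntegrand e₀ x₀ (z.1, z.2, p)
            ∂(posMeasure E).prod (DualComplex.hypMeasure V) ∂posMeasure Δ.Face :=
          integral_congr_ae ((ae_posMeasure Δ.Face).mono fun p hp => (horig p hp).symm)
      _ = ∫ z : (E → ℝ) × (V → Fin 4 → H3), Δ.faceFactoredIntegrand e₀ x₀ z.1 z.2
            ∂(posMeasure E).prod (DualComplex.hypMeasure V) := by
          -- Exchange of the order of integration, licensed by joint integrability.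
          rw [← integral_prod_symm _ hfull, integral_prod _ hfull]
          exact integral_congr_ae (.of_forall fun z => Δ.integral_fiber e₀ x₀ z)
      _ = Δ.faceFactoredPartitionFunction e₀ x₀ :=
          integral_prod _
            (hfull.integral_prod_left.congr (.of_forall fun z => Δ.integral_fiber e₀ x₀ z))
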